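/- Let $n$ be a number of qubits and let $\hat c_1,\dots,\hat c_{2n}$ be the Jordan--Wigner generators acting on $(\mathbb C^2)^{\otimes n}$, $$\hat c_{2j-1}=\sigma^z_1\otimes\cdots\otimes\sigma^z_{j-1}\otimes\sigma^x_j\otimes I\otimes\cdots\otimes I,\qquad \hat c_{2j}=\sigma^z_1\otimes\cdots\otimes\sigma^z_{j-1}\otimes\sigma^y_j\otimes I\otimes\cdots\otimes I .$$ The monomials $\hat c(\mathbf x)=\hat c_1^{x_1}\cdots\hat c_{2n}^{x_{2n}}$, $\mathbf x\in\{0,1\}^{2n}$, form a basis of the space of linear operators on $n$ qubits. For real numbers $0\le b_1,\dots,b_{2n}\le 1$, the fermionic product channel with attenuation coefficients $b_1,\dots,b_{2n}$ is the linear map $\Phi$ on operators with $$\Phi(\hat c(\mathbf x))=\Big(\prod_{p:\,x_p=1}b_p\Big)\,\hat c(\mathbf x)\qquad\text{for all }\mathbf x .$$ For real $\lambda=(\lambda_1,\dots,\lambda_n)$ put $\rho_\lambda=2^{-n}\prod_{j=1}^n (I-i\lambda_j\hat c_{2j-1}\hat c_{2j})$. A state $\rho$ (a positive semidefinite operator of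 trace one) is called Gaussian if $\rho=U\rho_\lambda U^\dagger$ with $U=\exp(iH_2+iH_1)$ for some real $\lambda$, some Hermitian linear combination $H_2$ of the products $\hat c_p\hat c_q$ and some Hermitian linear combination $H_1$ of the generators $\hat c_p$; it is called even Gaussian if this is possible with $H_1=0$. The covariance matrix of $\rho$ is the $2n\times 2n$ matrix $M_{pq}=-\frac i2\operatorname{Tr}[\rho(\hat c_p\hat c_q-\hat c_q\hat c_p)]$. Then: 1. If $\rho$ is a Gaussian state, then $\Phi(\rho)$ is a Gaussian state. 2. If $\rho$ is an even Gaussian state with covariance matrix $M$, then $\Phi(\rho)$ is an even Gaussian state and its covariance matrix is $BMB^T$, where $B=\mathrm{diag}(b_1,\dots,b_{2n})$. -/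

import Mathlib

noncomputable section

namespace Fermion

open Matrix Complex
open scoped ComplexOrder

/-- Linear operators on `n` qubits, as matrices in the standard basis, whose elements are
the bit strings of length `n`. -/
abbrev Operator (n : ℕ) : Type := Matrix (Fin n → Fin 2) (Fin n → Fin 2) ℂ

/-- The Pauli matrix `σˣ`. -/
def pauliX : Matrix (Fin 2) (Fin 2) ℂ := !![0, 1; 1, 0]

/-- The Pauli matrix `σʸ`. -/
def pauliY : Matrix (Fin 2) (Fin 2) ℂ := !![0, -I; I, 0]

/-- The Pauli matrix `σᶻ`. -/
def pauliZ : Matrix (Fin 2) (Fin 2) ℂ := !![1, 0; 0, -1]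

/-- The tensor product `A 0 ⊗ A 1 ⊗ ⋯ ⊗ A (n - 1)` of one-qubit operators. -/
def qubitTensor {n : ℕ} (A : Fin n → Matrix (Fin 2) (Fin 2) ℂ) : Operator n :=
  Matrix.of fun s t => ∏ k, A k (s k) (t k)

/-- The one-qubit factor on the qubit `k` of the generator number `p` (counted from `0`). -/
def majoranaFactor {n : ℕ} (p : Fin (2 * n)) (k : Fin n) : Matrix (Fin 2) (Fin 2) ℂ :=
  if (k : ℕ) < (p : ℕ) / 2 then pauliZ
  else if (k : ℕ) = (p : ℕ) / 2 then (if (p : ℕ) % 2 = 0 then pauliX else pauliY)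
  else 1

/-- The generators `ĉ₁, …, ĉ₂ₙ` given by the Jordan-Wigner transformation; the index counts
from `0`, so `majorana p` is `ĉ_{p+1}`. -/
def majorana {n : ℕ} (p : Fin (2 * n)) : Operator n :=
  qubitTensor (majoranaFactor p)

/-- The monomial `ĉ(x) = ĉ₁^{x₁} ĉ₂^{x₂} ⋯ ĉ₂ₙ^{x₂ₙ}`, for a binary string `x`. -/
def monomial {n : ℕ} (x : Fin (2 * n) → Fin 2) : Operator n :=
  (List.ofFn fun p => majorana p ^ (x p : ℕ)).prod

/-! The monomials form a basis of the space of operators. -/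

theorem qubitTensor_mul {n : ℕ} (A B : Fin n → Matrix (Fin 2) (Fin 2) ℂ) :
    qubitTensor A * qubitTensor B = qubitTensor fun k => A k * B k := by
  ext s t
  simp only [qubitTensor, Matrix.mul_apply, Matrix.of_apply, ← Finset.prod_mul_distrib]
  rw [Finset.prod_univ_sum]
  simp

theorem qubitTensor_one {n : ℕ} : qubitTensor (fun _ : Fin n => 1) = (1 : Operator n) := by
  ext s t
  simp only [qubitTensor, Matrix.of_apply, Matrix.one_apply]
  by_cases h : s = t
  · subst h
    simp
  · rw [if_neg h]
    obtain ⟨k, hk⟩ := Function.ne_iff.mp h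
    exact Finset.prod_eq_zero (Finset.mem_univ k) (by simp [hk])

theorem pauli_relations :
    pauliX * pauliX = 1 ∧ pauliY * pauliY = 1 ∧ pauliZ * pauliZ = 1 ∧
    pauliX * pauliY = -(pauliY * pauliX) ∧ pauliX * pauliZ = -(pauliZ * pauliX) ∧
    pauliY * pauliZ = -(pauliZ * pauliY) := by
  refine ⟨?_, ?_, ?_, ?_, ?_, ?_⟩ <;> ext i j <;> fin_cases i <;> fin_cases j <;>
    simp [pauliX, pauliY, pauliZ, Matrix.mul_apply]

theorem majorana_mul_self {n : ℕ} (p : Fin (2 * n)) : majorana p * majorana p = 1 := by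
  obtain ⟨hx, hy, hz, -, -, -⟩ := pauli_relations
  rw [majorana, qubitTensor_mul, ← qubitTensor_one]
  congr 1
  funext k
  unfold majoranaFactor
  split_ifs <;> simp [hx, hy, hz]

theorem majorana_anticomm {n : ℕ} {p q : Fin (2 * n)} (h : p ≠ q) :
    majorana p * majorana q = -(majorana q * majorana p) := by
  obtain ⟨-, -, -, hxy, hxz, hyz⟩ := pauli_relations
  wlog hpq : p < q generalizing p q
  · rw [this h.symm (lt_of_le_of_ne (not_lt.mp hpq) h.symm), neg_neg]
  have hpq' : (p : ℕ) < q := hpq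
  have hm : (p : ℕ) / 2 < n := by omega
  have key : ∀ k : Fin n, majoranaFactor p k * majoranaFactor q k =
      (if k = ⟨(p : ℕ) / 2, hm⟩ then (-1 : ℂ) else 1) •
        (majoranaFactor q k * majoranaFactor p k) := by
    intro k
    simp only [Fin.ext_iff]
    unfold majoranaFactor
    split_ifs <;> first | omega | simp [hxy, hxz, hyz]
  rw [majorana, majorana, qubitTensor_mul, qubitTensor_mul]
  ext s t
  simp only [qubitTensor, Matrix.of_apply, Matrix.neg_apply, key, Matrix.smul_apply,
    smul_eq_mul, Finset.prod_mul_distrib]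
  simp

theorem majorana_mul_monomial {n : ℕ} (q : Fin (2 * n)) (x : Fin (2 * n) → Fin 2) :
    majorana q * monomial x =
      ((∏ p, (-1 : ℂ) ^ (x p : ℕ)) * (-1) ^ (x q : ℕ)) • (monomial x * majorana q) := by
  have hs : ((∏ p, (-1 : ℂ) ^ (x p : ℕ)) * (-1) ^ (x q : ℕ)) =
      ∏ p, (if p = q then 1 else (-1 : ℂ) ^ (x p : ℕ)) := by
    rw [← Finset.mul_prod_erase _ _ (Finset.mem_univ q),
      ← Finset.mul_prod_erase Finset.univ (fun p => if p = q then 1 else _) (Finset.mem_univ q),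
      mul_right_comm, ← pow_add, ← two_mul, pow_mul]
    simp only [even_two, Even.neg_pow, one_pow, one_mul, if_true]
    exact Finset.prod_congr rfl fun p hp => by rw [if_neg (Finset.ne_of_mem_erase hp)]
  have hone : ∀ p, majorana q * majorana p ^ (x p : ℕ) =
      (if p = q then 1 else (-1 : ℂ) ^ (x p : ℕ)) • (majorana p ^ (x p : ℕ) * majorana q) := by
    intro p
    by_cases hp : p = q
    · subst hp
      simp [← pow_succ, ← pow_succ']
    · rw [if_neg hp]
      generalize x p = a
      fin_cases a
      · simp
      · simp [majorana_anticomm (Ne.symm hp)]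
  rw [hs, monomial, ← List.prod_ofFn]
  simp only [List.ofFn_eq_map]
  induction List.finRange (2 * n) with
  | nil => simp
  | cons p l ih =>
    simp only [List.map_cons, List.prod_cons]
    rw [← mul_assoc, hone p, smul_mul_assoc, mul_assoc, ih, mul_smul_comm, smul_smul, mul_assoc]

theorem exists_monomial_left_inverse {n : ℕ} (x : Fin (2 * n) → Fin 2) :
    ∃ D : Operator n, D * monomial x = 1 ∧ ∀ q, majorana q * D =
      ((∏ p, (-1 : ℂ) ^ (x p : ℕ)) * (-1) ^ (x q : ℕ)) • (D * majorana q) := by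
  have hu : ∃ D : Operator n, D * monomial x = 1 := by
    rw [monomial, List.ofFn_eq_map]
    induction List.finRange (2 * n) with
    | nil => exact ⟨1, by simp⟩
    | cons p l ih =>
      obtain ⟨D, hD⟩ := ih
      refine ⟨D * majorana p ^ (x p : ℕ), ?_⟩
      rw [List.map_cons, List.prod_cons, mul_assoc, ← mul_assoc (majorana p ^ _),
        ← (Commute.refl (majorana p)).mul_pow, majorana_mul_self, one_pow, one_mul, hD]
  obtain ⟨D, hD⟩ := hu
  have hD' : monomial x * D = 1 := mul_eq_one_comm.mp hD
  refine ⟨D, hD, fun q => ?_⟩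
  have h := congrArg (fun A => D * A * D) (majorana_mul_monomial q x)
  simp only [mul_smul_comm, smul_mul_assoc] at h
  rw [mul_assoc, mul_assoc, hD', mul_one, ← mul_assoc D, hD, one_mul] at h
  have hsq : ((∏ p, (-1 : ℂ) ^ (x p : ℕ)) * (-1) ^ (x q : ℕ)) *
      ((∏ p, (-1 : ℂ) ^ (x p : ℕ)) * (-1) ^ (x q : ℕ)) = 1 := by
    rw [mul_mul_mul_comm, ← Finset.prod_mul_distrib]
    simp only [← mul_pow]
    simp
  rw [h, smul_smul, hsq, one_smul]

theorem sign_separates {n : ℕ} {x y : Fin (2 * n) → Fin 2}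
    (h : ∀ q, ((∏ p, (-1 : ℂ) ^ (x p : ℕ)) * (-1) ^ (x q : ℕ)) =
      ((∏ p, (-1 : ℂ) ^ (y p : ℕ)) * (-1) ^ (y q : ℕ))) : x = y := by
  have hsq : ∀ z : Fin (2 * n) → Fin 2, (∏ p, (-1 : ℂ) ^ (z p : ℕ)) ^ (2 * n) = 1 := by
    intro z
    rw [pow_mul, ← Finset.prod_pow]
    simp only [← pow_mul, mul_comm _ 2]
    simp
  have hT : (∏ p, (-1 : ℂ) ^ (x p : ℕ)) = ∏ p, (-1 : ℂ) ^ (y p : ℕ) := by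
    have := Finset.prod_congr (rfl : (Finset.univ : Finset (Fin (2 * n))) = Finset.univ)
      (fun q _ => h q)
    simpa [Finset.prod_mul_distrib, Finset.prod_const, hsq] using this
  have hne : (∏ p, (-1 : ℂ) ^ (y p : ℕ)) ≠ 0 := by
    simp [Finset.prod_ne_zero_iff]
  funext q
  have hq := h q
  rw [hT] at hq
  have hq' := mul_left_cancel₀ hne hq
  have two : ∀ a b : Fin 2, (-1 : ℂ) ^ (a : ℕ) = (-1) ^ (b : ℕ) → a = b := by
    intro a b
    fin_cases a <;> fin_cases b <;> norm_num
  exact two _ _ hq'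

theorem linearIndependent_monomial (n : ℕ) :
    LinearIndependent ℂ (monomial : (Fin (2 * n) → Fin 2) → Operator n) := by
  rw [Fintype.linearIndependent_iff]
  intro a ha x
  obtain ⟨D, hD, hDq⟩ := exists_monomial_left_inverse x
  have horth : ∀ y, y ≠ x → (D * monomial y).trace = 0 := by
    intro y hy
    by_contra hne
    apply hy
    apply sign_separates
    intro q
    have h1 : (D * monomial y).trace =
        (majorana q * (D * monomial y) * majorana q).trace := by
      rw [Matrix.trace_mul_comm (majorana q * _), ← mul_assoc, majorana_mul_self, one_mul]
    rw [← mul_assoc, hDq q, smul_mul_assoc, smul_mul_assoc, mul_assoc D,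
      majorana_mul_monomial q y, mul_smul_comm, smul_mul_assoc, mul_assoc D, mul_assoc (monomial y),
      majorana_mul_self, mul_one, smul_smul, Matrix.trace_smul, smul_eq_mul] at h1
    have h2 := mul_right_cancel₀ hne ((one_mul _).trans h1)
    have hsq : ((∏ p, (-1 : ℂ) ^ (x p : ℕ)) * (-1) ^ (x q : ℕ)) *
        ((∏ p, (-1 : ℂ) ^ (x p : ℕ)) * (-1) ^ (x q : ℕ)) = 1 := by
      rw [mul_mul_mul_comm, ← Finset.prod_mul_distrib]
      simp only [← mul_pow]
      simp
    have h3 := congrArg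
      (fun z => ((∏ p, (-1 : ℂ) ^ (x p : ℕ)) * (-1) ^ (x q : ℕ)) * z) h2
    simp only [mul_one] at h3
    rw [← mul_assoc, hsq, one_mul] at h3
    exact h3.symm
  have h := congrArg (fun A => (D * A).trace) ha
  simp only [Finset.mul_sum, Matrix.trace_sum, mul_smul_comm, Matrix.trace_smul, mul_zero,
    Matrix.trace_zero] at h
  rw [Finset.sum_eq_single x (fun y _ hy => by rw [horth y hy, smul_zero]) (by simp), hD,
    Matrix.trace_one, smul_eq_mul] at h
  simpa using h

/-- The basis of the space of `n`-qubit operators formed by the `4ⁿ` monomials `ĉ(x)`. -/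
def monomialBasis (n : ℕ) : Module.Basis (Fin (2 * n) → Fin 2) ℂ (Operator n) :=
  basisOfLinearIndependentOfCardEqFinrank (linearIndependent_monomial n) (by
    rw [Module.finrank_matrix]
    simp [pow_mul, ← mul_pow])

/-- The fermionic product channel with coefficients `b`: the linear map determined by
`ĉ(x) ↦ (∏_{p : x_p = 1} b_p) ĉ(x)` for every binary string `x`. -/
def productChannel {n : ℕ} (b : Fin (2 * n) → ℝ) : Operator n →ₗ[ℂ] Operator n :=
  (monomialBasis n).constr ℂ fun x =>
    (∏ p with x p = 1, (b p : ℂ)) • monomial x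

theorem productChannel_monomial {n : ℕ} (b : Fin (2 * n) → ℝ) (x : Fin (2 * n) → Fin 2) :
    productChannel b (monomial x) = (∏ p with x p = 1, (b p : ℂ)) • monomial x := by
  have h := (monomialBasis n).constr_basis ℂ
    (fun x => (∏ p with x p = 1, (b p : ℂ)) • monomial x) x
  rwa [monomialBasis, coe_basisOfLinearIndependentOfCardEqFinrank] at h

/-- A state (density operator) of `n` qubits. -/
def IsState {n : ℕ} (ρ : Operator n) : Prop :=
  ρ.PosSemidef ∧ ρ.trace = 1

/-- `ρ_λ = 2⁻ⁿ ∏ⱼ (I - i λⱼ ĉ_{2j-1} ĉ_{2j})`. -/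
def standardGaussian {n : ℕ} (lam : Fin n → ℝ) : Operator n :=
  ((1 : ℂ) / 2 ^ n) • (List.ofFn fun j : Fin n =>
    1 - (I * (lam j : ℂ)) •
      (majorana ⟨2 * (j : ℕ), by omega⟩ * majorana ⟨2 * (j : ℕ) + 1, by omega⟩)).prod

/-- `H` is a Hermitian (complex) linear combination of the products `ĉ_p ĉ_q`. -/
def IsQuadraticHamiltonian {n : ℕ} (H : Operator n) : Prop :=
  H.IsHermitian ∧ ∃ h : Fin (2 * n) → Fin (2 * n) → ℂ,
    H = ∑ p, ∑ q, h p q • (majorana p * majorana q)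

/-- `H` is a Hermitian (complex) linear combination of the generators `ĉ_p`. -/
def IsLinearHamiltonian {n : ℕ} (H : Operator n) : Prop :=
  H.IsHermitian ∧ ∃ h : Fin (2 * n) → ℂ, H = ∑ p, h p • majorana p

/-- Gaussian states: states of the form `U ρ_λ U†` with `U = exp (i H₂ + i H₁)`. -/
def IsGaussian {n : ℕ} (ρ : Operator n) : Prop :=
  IsState ρ ∧ ∃ (lam : Fin n → ℝ) (H₂ H₁ : Operator n),
    IsQuadraticHamiltonian H₂ ∧ IsLinearHamiltonian H₁ ∧
    ρ = NormedSpace.exp (I • H₂ + I • H₁) * standardGaussian lam *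
      (NormedSpace.exp (I • H₂ + I • H₁))ᴴ

/-- Even Gaussian states: states of the form `U ρ_λ U†` with `U = exp (i H₂)`. -/
def IsEvenGaussian {n : ℕ} (ρ : Operator n) : Prop :=
  IsState ρ ∧ ∃ (lam : Fin n → ℝ) (H₂ : Operator n),
    IsQuadraticHamiltonian H₂ ∧
    ρ = NormedSpace.exp (I • H₂) * standardGaussian lam * (NormedSpace.exp (I • H₂))ᴴ

/-- The covariance matrix `M_{pq} = -(i/2) Tr [ρ (ĉ_p ĉ_q - ĉ_q ĉ_p)]`. -/
def covarianceMatrix {n : ℕ} (ρ : Operator n) : Matrix (Fin (2 * n)) (Fin (2 * n)) ℂ :=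
  Matrix.of fun p q =>
    -(I / 2) * (ρ * (majorana p * majorana q - majorana q * majorana p)).trace

end Fermion

end

/-! Together with the parity operator P, the operators `i ĉ_p P` form 2n+1 anticommuting Hermitian
involutions γ. Since `i ĉ_p` is itself a product of two of them, a Hamiltonian `H₂ + H₁` is purely
quadratic in the γ, and conjugation by its exponential rotates the γ by a matrix exp A with A real
and skew of size 2n+1. Even Hamiltonians are those fixing the axis of P.

Gaussianity is then expressed by linear equations (`GaussianEquation`): [γ(v), X] = i{γ(Nv), X} for
all v, with N real and skew. The operator ρ_λ solves them with N block diagonal, and conjugating X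
by exp(iH₂ + iH₁) conjugates N by exp A. The trace determines the solution
(`GaussianEquation.eq_of_trace_eq`), and every skew N is conjugate under exponentials of skew
matrices to a block diagonal one (`exists_skew_exp_conj_commute`, `exists_eq_blockForm`). Hence a
state is Gaussian exactly when it solves the equations for some skew N, and even Gaussian exactly
when N also kills the axis of P.

The channel is a composition of channels attenuating one generator, each a convex combination of X
and γ_r X γ_r. Such a channel turns the equations for N into those for BNB
(`GaussianEquation.singleChannel`). Skewness and the kernel condition survive, so Gaussianity and
evenness do too. For trace one, N restricted to the ĉ indices is the covariance matrix
(`covarianceMatrix_eq`), which gives BMBᵀ. -/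

namespace Fermion

open Matrix Complex
open scoped ComplexOrder

/-! ### Linear differential equations and exponentials in a Banach algebra -/

section ExponentialFlow

variable {𝔸 𝔹 : Type*} [NormedRing 𝔸] [NormedAlgebra ℝ 𝔸] [CompleteSpace 𝔸]
  [NormedRing 𝔹] [NormedAlgebra ℝ 𝔹] [CompleteSpace 𝔹]

theorem eq_exp_smul_mul_of_hasDerivAt {F : ℝ → 𝔸} {a : 𝔸}
    (hF : ∀ t, HasDerivAt F (a * F t) t) (t : ℝ) :
    F t = NormedSpace.exp (t • a) * F 0 := by
  have hG : ∀ s, HasDerivAt (fun s : ℝ => NormedSpace.exp (s • -a) * F s) 0 s := by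
    intro s
    have h := (hasDerivAt_exp_smul_const (-a) s).mul (hF s)
    refine h.congr_deriv ?_
    noncomm_ring
  have hc := is_const_of_deriv_eq_zero (fun s => (hG s).differentiableAt)
    (fun s => (hG s).deriv) t 0
  simp only [zero_smul, NormedSpace.exp_zero, one_mul] at hc
  let : NormedAlgebra ℚ 𝔸 := NormedAlgebra.restrictScalars ℚ ℝ 𝔸
  have hinv : NormedSpace.exp (t • a) * NormedSpace.exp (t • -a) = 1 := by
    rw [smul_neg, ← NormedSpace.exp_add_of_commute (Commute.refl (t • a)).neg_right, add_neg_cancel,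
      NormedSpace.exp_zero]
  rw [← hc, ← mul_assoc, hinv, one_mul]

/-- The curve F(t) = L(exp(ta)) exp(tk) satisfies F' = kF, because the commutator hypothesis moves k
to the left of L. This integrates an infinitesimal action to its exponential without iterated
commutators. -/
theorem map_exp_mul_exp_of_commutator (L : 𝔹 →L[ℝ] 𝔸) (k : 𝔸) (a : 𝔹)
    (h : ∀ x, k * L x - L x * k = L (a * x)) :
    L (NormedSpace.exp a) * NormedSpace.exp k = NormedSpace.exp k * L 1 := by
  have hF : ∀ t : ℝ, HasDerivAt
      (fun t : ℝ => L (NormedSpace.exp (t • a)) * NormedSpace.exp (t • k))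
      (k * (L (NormedSpace.exp (t • a)) * NormedSpace.exp (t • k))) t := by
    intro t
    have h1 := (L.hasFDerivAt.comp_hasDerivAt t (hasDerivAt_exp_smul_const' a t)).mul
      (hasDerivAt_exp_smul_const' k t)
    refine h1.congr_deriv ?_
    simp only [Function.comp_apply]
    rw [← h]
    noncomm_ring
  simpa using eq_exp_smul_mul_of_hasDerivAt hF 1

/-- Rodrigues' formula: the right-hand side solves F' = aF with F(0) = 1. -/
theorem exp_smul_of_pow_three_eq_neg {a : 𝔸} (ha : a * a * a = -a) (t : ℝ) :
    NormedSpace.exp (t • a) = 1 + Real.sin t • a + (1 - Real.cos t) • (a * a) := by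
  have hF : ∀ t : ℝ, HasDerivAt
      (fun t : ℝ => 1 + Real.sin t • a + (1 - Real.cos t) • (a * a))
      (a * (1 + Real.sin t • a + (1 - Real.cos t) • (a * a))) t := by
    intro t
    have h1 := (((Real.hasDerivAt_sin t).smul_const a).const_add 1).add
      (((Real.hasDerivAt_cos t).const_sub 1).smul_const (a * a))
    refine h1.congr_deriv ?_
    simp only [mul_add, mul_smul_comm, ← mul_assoc, ha, mul_one]
    module
  simpa using (eq_exp_smul_mul_of_hasDerivAt hF t).symm

end ExponentialFlow

/-! ### Special orthogonal and skew-symmetric real matrices -/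

section RealMatrices

variable {ι : Type*} [Fintype ι] [DecidableEq ι]

theorem exp_mulVec_of_mulVec_eq_zero {A : Matrix ι ι ℝ} {x : ι → ℝ} (h : A *ᵥ x = 0) :
    NormedSpace.exp A *ᵥ x = x := by
  let := Matrix.linftyOpNormedRing (n := ι) (α := ℝ)
  let := Matrix.linftyOpNormedAlgebra (n := ι) (R := ℝ) (α := ℝ)
  -- The differential equation is stated inside an algebra, so the constant solution x is replaced
  -- by the matrix x xᵀ.
  have hx : A * vecMulVec x x = 0 := by rw [mul_vecMulVec, h, zero_vecMulVec]
  have h1 := eq_exp_smul_mul_of_hasDerivAt (F := fun _ : ℝ => vecMulVec x x) (a := A)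
    (fun t => by rw [hx]; exact hasDerivAt_const _ _) 1
  rw [one_smul, mul_vecMulVec] at h1
  by_cases h0 : x = 0
  · simp [h0]
  obtain ⟨j, hj⟩ := Function.ne_iff.mp h0
  funext i
  have h2 := congrFun (congrFun h1 i) j
  simp only [vecMulVec_apply] at h2
  exact (mul_right_cancel₀ hj h2).symm

theorem transpose_exp_of_skew {A : Matrix ι ι ℝ} (hA : Aᵀ = -A) :
    (NormedSpace.exp A)ᵀ = NormedSpace.exp (-A) := by
  rw [← Matrix.exp_transpose, hA]

theorem exp_neg_mul_exp (A : Matrix ι ι ℝ) : NormedSpace.exp (-A) * NormedSpace.exp A = 1 := by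
  rw [← Matrix.exp_add_of_commute _ _ (Commute.refl A).neg_left, neg_add_cancel,
    NormedSpace.exp_zero]

theorem exp_mul_exp_neg (A : Matrix ι ι ℝ) : NormedSpace.exp A * NormedSpace.exp (-A) = 1 :=
  mul_eq_one_comm.mp (exp_neg_mul_exp A)

/-- exp A is the square of the orthogonal matrix exp(A/2), whose determinant squares to 1. -/
theorem det_exp_of_skew {A : Matrix ι ι ℝ} (hA : Aᵀ = -A) : (NormedSpace.exp A).det = 1 := by
  have h2 : NormedSpace.exp A =
      NormedSpace.exp ((1 / 2 : ℝ) • A) * NormedSpace.exp ((1 / 2 : ℝ) • A) := by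
    rw [← Matrix.exp_add_of_commute _ _ (Commute.refl _), ← add_smul]
    norm_num
  have h3 : ((1 / 2 : ℝ) • A)ᵀ = -((1 / 2 : ℝ) • A) := by rw [transpose_smul, hA, smul_neg]
  have h4 := congrArg det (exp_neg_mul_exp ((1 / 2 : ℝ) • A))
  rw [← transpose_exp_of_skew h3, det_mul, det_transpose, det_one] at h4
  rw [h2, det_mul, h4]

theorem exists_unit_eigenvector_of_ne_zero {S : Matrix ι ι ℝ} (hS : Sᵀ = S) (h0 : S ≠ 0) :
    ∃ (μ : ℝ) (v : ι → ℝ), μ ≠ 0 ∧ v ⬝ᵥ v = 1 ∧ S *ᵥ v = μ • v := by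
  have hH : S.IsHermitian := by
    rw [Matrix.IsHermitian, conjTranspose_eq_transpose_of_trivial, hS]
  have hne : hH.eigenvalues ≠ 0 := fun h => h0 (hH.eigenvalues_eq_zero_iff.mp h)
  obtain ⟨j, hj⟩ := Function.ne_iff.mp hne
  refine ⟨hH.eigenvalues j, hH.eigenvectorBasis j, hj, ?_, hH.mulVec_eigenvectorBasis j⟩
  have h := hH.eigenvectorBasis.orthonormal.1 j
  rw [EuclideanSpace.norm_eq, Real.sqrt_eq_one] at h
  simpa [dotProduct, sq] using h

theorem mulVec_dotProduct_mulVec_of_orthogonal {T : Matrix ι ι ℝ} (hT : Tᵀ * T = 1)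
    (v w : ι → ℝ) : (T *ᵥ v) ⬝ᵥ (T *ᵥ w) = v ⬝ᵥ w := by
  rw [dotProduct_mulVec, vecMul_mulVec, hT, vecMul_one]

theorem exists_unit_mulVec_eq_neg {T : Matrix ι ι ℝ} (hT : Tᵀ * T = 1) (hdet : T.det = -1) :
    ∃ w, w ⬝ᵥ w = 1 ∧ T *ᵥ w = -w := by
  have h0 : (T + 1).det = 0 := by
    have h1 : Tᵀ * (T + 1) = (T + 1)ᵀ := by
      rw [mul_add, hT, mul_one, transpose_add, transpose_one, add_comm]
    have h2 := congrArg det h1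
    rw [det_mul, det_transpose, det_transpose, hdet] at h2
    linarith
  obtain ⟨w, hw, hTw⟩ := exists_mulVec_eq_zero_iff.mpr h0
  have hpos : 0 < w ⬝ᵥ w := by
    have h := dotProduct_star_self_pos_iff.mpr hw
    simpa using h
  have hs := Real.sq_sqrt hpos.le
  have hs0 : Real.sqrt (w ⬝ᵥ w) ≠ 0 := (Real.sqrt_pos.mpr hpos).ne'
  refine ⟨(Real.sqrt (w ⬝ᵥ w))⁻¹ • w, ?_, ?_⟩
  · rw [smul_dotProduct, dotProduct_smul, smul_eq_mul, smul_eq_mul]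
    field_simp
    exact hs.symm
  · rw [add_mulVec, one_mulVec] at hTw
    rw [mulVec_smul, eq_neg_of_add_eq_zero_left hTw, smul_neg]

/-- T + Tᵀ - 2 is symmetric, and nonzero because it equals -(T-1)ᵀ(T-1). An eigenvector v with
eigenvalue 2c - 2 satisfies T²v = 2cTv - v, so v and Tv span an invariant subspace. It is a plane
unless Tv = -v, where the determinant supplies a second vector. -/
theorem exists_rotation_plane {T : Matrix ι ι ℝ} (hT : Tᵀ * T = 1) (hdet : T.det = 1)
    (h1 : T ≠ 1) : ∃ (v w : ι → ℝ) (c s : ℝ), v ⬝ᵥ v = 1 ∧ w ⬝ᵥ w = 1 ∧ v ⬝ᵥ w = 0 ∧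
      c ≠ 1 ∧ c ^ 2 + s ^ 2 = 1 ∧ T *ᵥ v = c • v + s • w ∧ T *ᵥ w = -s • v + c • w := by
  have hT' : T * Tᵀ = 1 := mul_eq_one_comm.mp hT
  have hS0 : T + Tᵀ - (2 : ℝ) • (1 : Matrix ι ι ℝ) ≠ 0 := by
    intro h
    apply h1
    rw [← sub_eq_zero, ← trace_conjTranspose_mul_self_eq_zero_iff,
      conjTranspose_eq_transpose_of_trivial, transpose_sub, transpose_one,
      sub_mul, mul_sub, hT, one_mul, mul_one]
    have : (1 : Matrix ι ι ℝ) - Tᵀ - (T - 1) = -(T + Tᵀ - (2 : ℝ) • (1 : Matrix ι ι ℝ)) := by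
      module
    rw [this, h, neg_zero, trace_zero]
  obtain ⟨μ, v, hμ, hv, hSv⟩ := exists_unit_eigenvector_of_ne_zero (by
    simp [add_comm]) hS0
  obtain ⟨c, rfl⟩ : ∃ c, μ = 2 * c - 2 := ⟨(μ + 2) / 2, by ring⟩
  have hTt : Tᵀ *ᵥ v = (2 * c) • v - T *ᵥ v := by
    simp only [sub_mulVec, add_mulVec, smul_mulVec, one_mulVec] at hSv
    linear_combination (norm := module) hSv
  have hc1 : c ≠ 1 := by rintro rfl; norm_num at hμ
  have hTT : T *ᵥ (T *ᵥ v) = (2 * c) • T *ᵥ v - v := by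
    have := congrArg (T *ᵥ ·) hTt
    simp only [mulVec_mulVec, hT', one_mulVec, mulVec_sub, mulVec_smul] at this
    rw [mulVec_mulVec]
    linear_combination (norm := module) this
  have hvT : v ⬝ᵥ T *ᵥ v = c := by
    have h2 : v ⬝ᵥ Tᵀ *ᵥ v = v ⬝ᵥ T *ᵥ v := by
      rw [mulVec_transpose, dotProduct_comm, ← dotProduct_mulVec]
    rw [hTt, dotProduct_sub, dotProduct_smul, hv, smul_eq_mul] at h2
    linarith
  have hTvTv : T *ᵥ v ⬝ᵥ T *ᵥ v = 1 := by rw [mulVec_dotProduct_mulVec_of_orthogonal hT, hv]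
  have hr : (T *ᵥ v - c • v) ⬝ᵥ (T *ᵥ v - c • v) = 1 - c ^ 2 := by
    simp only [sub_dotProduct, dotProduct_sub, smul_dotProduct, dotProduct_smul, hTvTv, hvT, hv,
      dotProduct_comm (T *ᵥ v) v, smul_eq_mul]
    ring
  have hr0 : 0 ≤ 1 - c ^ 2 := by
    rw [← hr]
    simpa using dotProduct_star_self_nonneg (T *ᵥ v - c • v)
  by_cases hc : c = -1
  · subst hc
    have hTv : T *ᵥ v = -v := by
      have h : (T *ᵥ v - (-1 : ℝ) • v) ⬝ᵥ (T *ᵥ v - (-1 : ℝ) • v) = 0 := by rw [hr]; norm_num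
      have := dotProduct_self_eq_zero.mp h
      linear_combination (norm := module) this
    -- Q is the reflection in v. TQ fixes v and has determinant -1, so it negates some w; that w is
    -- orthogonal to v, hence fixed by Q and negated by T.
    set Q : Matrix ι ι ℝ := 1 - (2 : ℝ) • vecMulVec v v with hQ
    have hQt : Qᵀ = Q := by simp [hQ, transpose_vecMulVec]
    have hQQ : Q * Q = 1 := by
      simp only [hQ, sub_mul, mul_sub, one_mul, mul_one, smul_mul_assoc, mul_smul_comm,
        vecMulVec_mul_vecMulVec, hv, one_smul]
      module
    have hQdet : Q.det = -1 := by
      have : Q = 1 + replicateCol Unit ((-2 : ℝ) • v) * replicateRow Unit v := by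
        rw [← vecMulVec_eq, smul_vecMulVec, hQ]
        module
      rw [this, det_one_add_replicateCol_mul_replicateRow, dotProduct_smul, hv]
      norm_num
    obtain ⟨w, hw, hTw⟩ := exists_unit_mulVec_eq_neg (T := T * Q)
      (by rw [transpose_mul, hQt, mul_assoc, ← mul_assoc Tᵀ, hT, one_mul, hQQ])
      (by rw [det_mul, hdet, hQdet, one_mul])
    have hQv : Q *ᵥ v = -v := by
      simp only [hQ, sub_mulVec, one_mulVec, smul_mulVec, vecMulVec_mulVec, hv, MulOpposite.op_one,
        one_smul]
      module
    have hvw : v ⬝ᵥ w = 0 := by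
      have h3 := mulVec_dotProduct_mulVec_of_orthogonal (T := T * Q)
        (by rw [transpose_mul, hQt, mul_assoc, ← mul_assoc Tᵀ, hT, one_mul, hQQ]) v w
      rw [hTw, ← mulVec_mulVec, hQv, mulVec_neg, hTv, neg_neg, dotProduct_neg] at h3
      linarith
    refine ⟨v, w, -1, 0, hv, hw, hvw, hc1, by norm_num, by simp [hTv], ?_⟩
    rw [← mulVec_mulVec] at hTw
    have hQw : Q *ᵥ w = w := by
      simp [hQ, sub_mulVec, smul_mulVec, vecMulVec_mulVec, hvw]
    rw [hQw] at hTw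
    simp [hTw]
  · have hpos : 0 < 1 - c ^ 2 := by
      refine lt_of_le_of_ne hr0 fun h => ?_
      have : (c - 1) * (c + 1) = 0 := by linarith
      rcases mul_eq_zero.mp this with h | h
      · exact hc1 (by linarith)
      · exact hc (by linarith)
    set s := Real.sqrt (1 - c ^ 2) with hs
    have hs2 : s ^ 2 = 1 - c ^ 2 := Real.sq_sqrt hr0
    have hs0 : s ≠ 0 := (Real.sqrt_pos.mpr hpos).ne'
    have hw : s • (s⁻¹ • (T *ᵥ v - c • v)) = T *ᵥ v - c • v := smul_inv_smul₀ hs0 _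
    refine ⟨v, s⁻¹ • (T *ᵥ v - c • v), c, s, hv, ?_, ?_, hc1, by rw [hs2]; ring, ?_, ?_⟩
    · rw [smul_dotProduct, dotProduct_smul, hr, ← hs2, smul_eq_mul, smul_eq_mul]
      field_simp
    · rw [dotProduct_smul, dotProduct_sub, dotProduct_smul, hv, hvT]
      simp
    · rw [hw]; abel
    · have hi : s * s⁻¹ = 1 := mul_inv_cancel₀ hs0
      have hs3 : s = s⁻¹ * (1 - c ^ 2) := by
        rw [← hs2]
        field_simp
      rw [mulVec_smul, mulVec_sub, mulVec_smul, hTT]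
      nth_rewrite 2 [hs3]
      module

/-- Surjectivity of the exponential onto SO, by induction towards larger fixed spaces: undoing the
rotation in one plane makes that plane fixed. The clause on fixed vectors makes the inductive A
vanish on the plane, so that it commutes with the plane's generator; it also serves the even case.
-/
theorem exists_skew_exp_eq {T : Matrix ι ι ℝ} (hT : Tᵀ * T = 1) (hdet : T.det = 1) :
    ∃ A : Matrix ι ι ℝ, Aᵀ = -A ∧ NormedSpace.exp A = T ∧ ∀ x, T *ᵥ x = x → A *ᵥ x = 0 := by
  induction hK : LinearMap.ker (T - 1).mulVecLin using WellFoundedGT.induction generalizing T with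
  | ind K ih =>
  have hmem : ∀ (R : Matrix ι ι ℝ) x, x ∈ LinearMap.ker (R - 1).mulVecLin ↔ R *ᵥ x = x := by
    intro R x
    rw [LinearMap.mem_ker, mulVecLin_apply, sub_mulVec, one_mulVec, sub_eq_zero]
  by_cases h1 : T = 1
  · exact ⟨0, by simp, by rw [h1, NormedSpace.exp_zero], by simp⟩
  obtain ⟨v, w, c, s, hv, hw, hvw, hc, hcs, hTv, hTw⟩ := exists_rotation_plane hT hdet h1
  have hwv : w ⬝ᵥ v = 0 := by rw [dotProduct_comm, hvw]
  have horth : ∀ x, T *ᵥ x = x → v ⬝ᵥ x = 0 ∧ w ⬝ᵥ x = 0 := by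
    intro x hx
    have ha : v ⬝ᵥ x = c * (v ⬝ᵥ x) + s * (w ⬝ᵥ x) := by
      have := mulVec_dotProduct_mulVec_of_orthogonal hT v x
      rw [hTv, hx, add_dotProduct, smul_dotProduct, smul_dotProduct] at this
      exact this.symm
    have hb : w ⬝ᵥ x = -s * (v ⬝ᵥ x) + c * (w ⬝ᵥ x) := by
      have := mulVec_dotProduct_mulVec_of_orthogonal hT w x
      rw [hTw, hx, add_dotProduct, smul_dotProduct, smul_dotProduct] at this
      exact this.symm
    -- `ha` and `hb` form a homogeneous linear system with determinant (1-c)² + s² = 2(1-c).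
    have hc' : 1 - c ≠ 0 := sub_ne_zero.mpr hc.symm
    constructor
    · have : (1 - c) * (v ⬝ᵥ x) = 0 := by linear_combination (1 - c) / 2 * ha + s / 2 * hb -
        (v ⬝ᵥ x) / 2 * hcs
      exact (mul_eq_zero.mp this).resolve_left hc'
    · have : (1 - c) * (w ⬝ᵥ x) = 0 := by linear_combination (1 - c) / 2 * hb - s / 2 * ha -
        (w ⬝ᵥ x) / 2 * hcs
      exact (mul_eq_zero.mp this).resolve_left hc'
  set J : Matrix ι ι ℝ := vecMulVec w v - vecMulVec v w with hJ
  have hJx : ∀ x, J *ᵥ x = (v ⬝ᵥ x) • w - (w ⬝ᵥ x) • v := by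
    intro x
    simp [hJ, sub_mulVec, vecMulVec_mulVec]
  have hJt : Jᵀ = -J := by simp [hJ, transpose_vecMulVec]
  have hJ3 : J * J * J = -J := by
    refine ext_of_mulVec_single fun j => ?_
    simp only [← mulVec_mulVec, neg_mulVec, hJx, dotProduct_sub, dotProduct_smul, hv, hw, hvw, hwv,
      smul_eq_mul]
    module
  obtain ⟨θ, hθc, hθs⟩ : ∃ θ : ℝ, Real.cos θ = c ∧ Real.sin θ = s := by
    have hn : ‖(⟨c, s⟩ : ℂ)‖ = 1 := by
      rw [Complex.norm_def, Complex.normSq_mk, Real.sqrt_eq_one]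
      linarith
    have h0 : (⟨c, s⟩ : ℂ) ≠ 0 := norm_ne_zero_iff.mp (by rw [hn]; exact one_ne_zero)
    exact ⟨Complex.arg ⟨c, s⟩, by rw [Complex.cos_arg h0, hn, div_one],
      by rw [Complex.sin_arg, hn, div_one]⟩
  have hθJ : (θ • J)ᵀ = -(θ • J) := by rw [transpose_smul, hJt, smul_neg]
  set E := NormedSpace.exp (-(θ • J)) with hE
  have hEE : NormedSpace.exp (θ • J) * E = 1 := exp_mul_exp_neg _
  have hEx : ∀ x, E *ᵥ x = x - s • J *ᵥ x + (1 - c) • J *ᵥ (J *ᵥ x) := by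
    intro x
    let := Matrix.linftyOpNormedRing (n := ι) (α := ℝ)
    let := Matrix.linftyOpNormedAlgebra (n := ι) (R := ℝ) (α := ℝ)
    have h : NormedSpace.exp (-θ • J) = _ := exp_smul_of_pow_three_eq_neg hJ3 (-θ)
    rw [hE, ← neg_smul, h, Real.sin_neg, Real.cos_neg, hθc, hθs, add_mulVec, add_mulVec, one_mulVec, smul_mulVec, smul_mulVec, ← mulVec_mulVec, neg_smul,
      ← sub_eq_add_neg]
  have hEt : Eᵀ * E = 1 := by
    rw [hE, ← transpose_exp_of_skew hθJ, transpose_transpose, transpose_exp_of_skew hθJ]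
    exact hEE
  have hTE : ∀ x, T *ᵥ x = x → (T * E) *ᵥ x = x := by
    intro x hx
    rw [← mulVec_mulVec, hEx, hJx, (horth x hx).1, (horth x hx).2]
    simp [hx]
  have hTEv : (T * E) *ᵥ v = v := by
    rw [← mulVec_mulVec, hEx]
    simp only [hJx, hv, hwv, mulVec_add, mulVec_sub, mulVec_smul, dotProduct_sub, dotProduct_smul,
      hvw, hw, hTv, hTw, smul_eq_mul]
    match_scalars <;> first | ring1 | linear_combination hcs
  have hTEw : (T * E) *ᵥ w = w := by
    rw [← mulVec_mulVec, hEx]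
    simp only [hJx, hv, hwv, mulVec_add, mulVec_sub, mulVec_smul, dotProduct_sub, dotProduct_smul,
      hvw, hw, hTv, hTw, smul_eq_mul]
    match_scalars <;> first | ring1 | linear_combination hcs
  have hlt : K < LinearMap.ker (T * E - 1).mulVecLin := by
    subst hK
    refine lt_of_le_of_ne (fun x hx => (hmem _ x).mpr (hTE x ((hmem _ x).mp hx))) fun h => ?_
    have hvK := (hmem T v).mp (h ▸ (hmem _ v).mpr hTEv)
    have := (horth v hvK).1
    rw [hv] at this
    exact one_ne_zero this
  obtain ⟨A, hA, hexp, hfix⟩ := ih _ hlt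
    (by rw [transpose_mul, mul_assoc, ← mul_assoc Tᵀ, hT, one_mul, hEt])
    (by rw [det_mul, hdet, one_mul, hE, ← transpose_exp_of_skew hθJ, det_transpose,
      det_exp_of_skew hθJ]) rfl
  have hAJ : A * J = 0 := by
    rw [hJ, mul_sub, mul_vecMulVec, mul_vecMulVec, hfix v hTEv, hfix w hTEw, zero_vecMulVec,
      zero_vecMulVec, sub_zero]
  have hJA : J * A = 0 := by
    have := congrArg transpose hAJ
    rwa [transpose_mul, hA, hJt, neg_mul_neg, transpose_zero] at this
  refine ⟨A + θ • J, by rw [transpose_add, hA, hθJ, neg_add], ?_, fun x hx => ?_⟩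
  · rw [Matrix.exp_add_of_commute _ _ (by
      rw [Commute, SemiconjBy, mul_smul_comm, smul_mul_assoc, hAJ, hJA]), hexp, mul_assoc,
      mul_eq_one_comm.mp hEE, mul_one]
  · rw [add_mulVec, hfix x (hTE x hx), smul_mulVec, hJx, (horth x hx).1, (horth x hx).2]
    simp

/-- Maximise tr(K Rᵀ N R) over the compact group of rotations R fixing W. With M = RᵀNR at a
maximum, the derivative in the direction X = [K, M] is tr X². Since X is skew, its vanishing forces
X = 0. The set W records axes that must stay fixed: it is empty for general states and holds the
parity axis for even ones. -/
theorem exists_skew_exp_conj_commute {N K : Matrix ι ι ℝ} (hN : Nᵀ = -N) (hK : Kᵀ = -K)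
    (W : Set (ι → ℝ)) (hNW : ∀ x ∈ W, N *ᵥ x = 0) (hKW : ∀ x ∈ W, K *ᵥ x = 0) :
    ∃ A : Matrix ι ι ℝ, Aᵀ = -A ∧ (∀ x ∈ W, A *ᵥ x = 0) ∧
      Commute K (NormedSpace.exp (-A) * N * NormedSpace.exp A) := by
  set G : Set (Matrix ι ι ℝ) := {R | Rᵀ * R = 1 ∧ R.det = 1 ∧ ∀ x ∈ W, R *ᵥ x = x} with hG
  have hGc : IsCompact G := by
    have hbox : IsCompact (Set.pi Set.univ fun _ : ι => Set.pi Set.univ fun _ : ι =>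
        Set.Icc (-1 : ℝ) 1) :=
      isCompact_univ_pi fun _ => isCompact_univ_pi fun _ => isCompact_Icc
    refine hbox.of_isClosed_subset ?_ ?_
    · refine IsClosed.and (isClosed_eq (by fun_prop) continuous_const)
        (IsClosed.and (isClosed_eq (by fun_prop) continuous_const) ?_)
      simp only [Set.ofPred_forall]
      exact isClosed_iInter fun x => isClosed_iInter fun _ =>
        isClosed_eq (by fun_prop) continuous_const
    · intro R hR i _ j _
      have hU : R ∈ unitaryGroup ι ℝ := mem_unitaryGroup_iff'.mpr hR.1
      have := entry_norm_bound_of_unitary hU i j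
      exact abs_le.mp this
  obtain ⟨R, hR, hmax⟩ := hGc.exists_isMaxOn (f := fun R => (K * (Rᵀ * N * R)).trace)
    ⟨1, by simp [hG]⟩ (by fun_prop)
  have hRt : R * Rᵀ = 1 := mul_eq_one_comm.mp hR.1
  set M := Rᵀ * N * R with hM
  have hMt : Mᵀ = -M := by
    simp only [hM, transpose_mul, transpose_transpose, hN, mul_neg, neg_mul, mul_assoc]
  have hMW : ∀ x ∈ W, M *ᵥ x = 0 := by
    intro x hx
    rw [hM, ← mulVec_mulVec, ← mulVec_mulVec, hR.2.2 x hx, hNW x hx, mulVec_zero]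
  set X := K * M - M * K with hX
  have hXt : Xᵀ = -X := by
    simp only [hX, transpose_sub, transpose_mul, hMt, hK, neg_mul_neg, neg_sub]
  have hXW : ∀ x ∈ W, X *ᵥ x = 0 := by
    intro x hx
    rw [hX, sub_mulVec, ← mulVec_mulVec x K, ← mulVec_mulVec x M, hMW x hx, hKW x hx, mulVec_zero,
      mulVec_zero, sub_zero]
  have hX0 : X = 0 := by
    let := Matrix.linftyOpNormedRing (n := ι) (α := ℝ)
    let := Matrix.linftyOpNormedAlgebra (n := ι) (R := ℝ) (α := ℝ)
    have hd : HasDerivAt (fun t : ℝ => K * (NormedSpace.exp (t • -X) * M *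
        NormedSpace.exp (t • X))) (K * (-X * M + M * X)) 0 := by
      have h := (((hasDerivAt_exp_smul_const (-X) (0 : ℝ)).mul_const M).mul
        (hasDerivAt_exp_smul_const X (0 : ℝ))).const_mul K
      refine h.congr_deriv ?_
      simp
    have htr := ((traceLinearMap ι ℝ ℝ).toContinuousLinearMap.hasFDerivAt.comp_hasDerivAt 0 hd)
    have hext : IsLocalMax (fun t : ℝ => (K * (NormedSpace.exp (t • -X) * M *
        NormedSpace.exp (t • X))).trace) 0 := by
      refine Filter.Eventually.of_forall fun t => ?_
      have htX : (t • X)ᵀ = -(t • X) := by rw [transpose_smul, hXt, smul_neg]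
      -- The variation stays in the group because X is skew and kills W.
      have hRG : R * NormedSpace.exp (t • X) ∈ G := by
        refine ⟨?_, ?_, fun x hx => ?_⟩
        · rw [transpose_mul, mul_assoc, ← mul_assoc Rᵀ, hR.1, one_mul, transpose_exp_of_skew htX,
            exp_neg_mul_exp]
        · rw [det_mul, hR.2.1, det_exp_of_skew htX, one_mul]
        · rw [← mulVec_mulVec, exp_mulVec_of_mulVec_eq_zero (by
            rw [smul_mulVec, hXW x hx, smul_zero]), hR.2.2 x hx]
      have h := hmax hRG
      simp only [Set.mem_ofPred_eq, transpose_mul, transpose_exp_of_skew htX] at h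
      simpa [hM, mul_assoc] using h
    have h0 := hext.hasDerivAt_eq_zero htr
    have h1 : (X * X).trace = 0 := by
      have h2 : (K * (-X * M + M * X)).trace = (X * X).trace := by
        nth_rewrite 3 [hX]
        simp only [mul_add, sub_mul, trace_add, trace_sub, neg_mul, mul_neg, trace_neg]
        rw [trace_mul_cycle' K X M]
        simp only [mul_assoc]
        ring
      rw [← h2]
      exact h0
    rw [← trace_conjTranspose_mul_self_eq_zero_iff, conjTranspose_eq_transpose_of_trivial, hXt,
      neg_mul, trace_neg, h1, neg_zero]
  obtain ⟨A, hA, hAR, hAfix⟩ := exists_skew_exp_eq hR.1 hR.2.1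
  refine ⟨A, hA, fun x hx => hAfix x (hR.2.2 x hx), ?_⟩
  rw [← transpose_exp_of_skew hA, hAR]
  exact sub_eq_zero.mp hX0

end RealMatrices

/-! ### Clifford generators extended by the parity operator -/

variable {n : ℕ}

/-- The parity operator `σᶻ ⊗ ⋯ ⊗ σᶻ`. -/
def parity (n : ℕ) : Operator n := qubitTensor fun _ => pauliZ

theorem conjTranspose_qubitTensor (A : Fin n → Matrix (Fin 2) (Fin 2) ℂ) :
    (qubitTensor A)ᴴ = qubitTensor fun k => (A k)ᴴ := by
  ext s t
  simp [qubitTensor, conjTranspose_apply]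

theorem conjTranspose_pauli : pauliXᴴ = pauliX ∧ pauliYᴴ = pauliY ∧ pauliZᴴ = pauliZ := by
  refine ⟨?_, ?_, ?_⟩ <;> ext i j <;> fin_cases i <;> fin_cases j <;>
    simp [pauliX, pauliY, pauliZ]

theorem conjTranspose_majorana (p : Fin (2 * n)) : (majorana p)ᴴ = majorana p := by
  obtain ⟨hx, hy, hz⟩ := conjTranspose_pauli
  rw [majorana, conjTranspose_qubitTensor]
  congr 1
  funext k
  unfold majoranaFactor
  split_ifs <;> simp [hx, hy, hz]

theorem conjTranspose_parity : (parity n)ᴴ = parity n := by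
  rw [parity, conjTranspose_qubitTensor, conjTranspose_pauli.2.2]

theorem parity_mul_self : parity n * parity n = 1 := by
  rw [parity, qubitTensor_mul, pauli_relations.2.2.1, qubitTensor_one]

theorem majorana_mul_parity (p : Fin (2 * n)) :
    majorana p * parity n = -(parity n * majorana p) := by
  obtain ⟨-, -, -, -, hxz, hyz⟩ := pauli_relations
  have hm : (p : ℕ) / 2 < n := by omega
  have key : ∀ k : Fin n, majoranaFactor p k * pauliZ =
      (if k = ⟨(p : ℕ) / 2, hm⟩ then (-1 : ℂ) else 1) • (pauliZ * majoranaFactor p k) := by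
    intro k
    simp only [Fin.ext_iff]
    unfold majoranaFactor
    split_ifs <;> first | omega | simp [hxz, hyz]
  rw [majorana, parity, qubitTensor_mul, qubitTensor_mul]
  ext s t
  simp only [qubitTensor, Matrix.of_apply, Matrix.neg_apply, key, Matrix.smul_apply,
    smul_eq_mul, Finset.prod_mul_distrib]
  simp

/-- `2n + 1` anticommuting Hermitian involutions: the parity operator `P` and the products
`i ĉ_p P`. -/
def extMajorana : Option (Fin (2 * n)) → Operator n
  | none => parity n
  | some p => I • (majorana p * parity n)

theorem parity_mul_majorana (p : Fin (2 * n)) :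
    parity n * majorana p = -(majorana p * parity n) := by
  rw [majorana_mul_parity, neg_neg]

theorem extMajorana_some_mul_some (p q : Fin (2 * n)) :
    extMajorana (some p) * extMajorana (some q) = majorana p * majorana q := by
  simp only [extMajorana, smul_mul_smul_comm, I_mul_I]
  rw [mul_assoc (majorana p), ← mul_assoc (parity n), parity_mul_majorana, neg_mul, mul_assoc,
    parity_mul_self]
  simp

theorem extMajorana_some_mul_none (p : Fin (2 * n)) :
    extMajorana (some p) * extMajorana none = I • majorana p := by
  simp [extMajorana, mul_assoc, parity_mul_self]

theorem extMajorana_none_mul_some (p : Fin (2 * n)) :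
    extMajorana none * extMajorana (some p) = -(I • majorana p) := by
  simp only [extMajorana]
  rw [mul_smul_comm, ← mul_assoc, parity_mul_majorana, neg_mul, mul_assoc, parity_mul_self,
    mul_one, smul_neg]

theorem extMajorana_mul_self (p : Option (Fin (2 * n))) :
    extMajorana p * extMajorana p = 1 := by
  cases p with
  | none => exact parity_mul_self
  | some p => rw [extMajorana_some_mul_some, majorana_mul_self]

theorem extMajorana_anticomm {p q : Option (Fin (2 * n))} (h : p ≠ q) :
    extMajorana p * extMajorana q = -(extMajorana q * extMajorana p) := by
  cases p <;> cases q
  · exact absurd rfl h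
  · rw [extMajorana_none_mul_some, extMajorana_some_mul_none]
  · rw [extMajorana_none_mul_some, extMajorana_some_mul_none, neg_neg]
  · rw [extMajorana_some_mul_some, extMajorana_some_mul_some,
      majorana_anticomm (by simpa using h)]

theorem extMajorana_clifford (p q : Option (Fin (2 * n))) :
    extMajorana p * extMajorana q + extMajorana q * extMajorana p =
      if p = q then (2 : ℂ) • (1 : Operator n) else 0 := by
  split_ifs with h
  · rw [h, extMajorana_mul_self, two_smul]
  · rw [extMajorana_anticomm h, neg_add_cancel]

theorem conjTranspose_extMajorana (p : Option (Fin (2 * n))) :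
    (extMajorana p)ᴴ = extMajorana p := by
  cases p with
  | none => exact conjTranspose_parity
  | some p =>
    simp [extMajorana, conjTranspose_smul, conjTranspose_parity, conjTranspose_majorana,
      parity_mul_majorana]

theorem trace_extMajorana_mul (p q : Option (Fin (2 * n))) :
    (extMajorana p * extMajorana q : Operator n).trace = if p = q then 2 ^ n else 0 := by
  have h := congrArg trace (extMajorana_clifford p q)
  rw [trace_add, trace_mul_comm (extMajorana q), ← two_mul] at h
  have h2 : (2 : ℂ) ≠ 0 := two_ne_zero
  apply mul_left_cancel₀ h2
  rw [h]
  split_ifs <;> simp [trace_smul, trace_one]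

/-- The real linear combination `∑ v_p γ_p` of the operators `extMajorana`. -/
noncomputable def extField : (Option (Fin (2 * n)) → ℝ) →ₗ[ℝ] Operator n :=
  Fintype.linearCombination ℝ extMajorana

theorem extField_apply (v : Option (Fin (2 * n)) → ℝ) :
    extField v = ∑ p, v p • (extMajorana p : Operator n) := rfl

theorem extField_single (p : Option (Fin (2 * n))) (a : ℝ) :
    extField (Pi.single p a) = a • (extMajorana p : Operator n) := by
  simp [extField]

theorem trace_extMajorana_mul_extField (p : Option (Fin (2 * n)))
    (v : Option (Fin (2 * n)) → ℝ) :
    (extMajorana p * extField v : Operator n).trace = v p * 2 ^ n := by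
  rw [extField_apply, Finset.mul_sum, trace_sum]
  simp [trace_extMajorana_mul]

/-- The γ are orthogonal for the trace form, so coefficients can be read off. -/
theorem extField_injective : Function.Injective (extField : _ →ₗ[ℝ] Operator n) := by
  intro v w h
  funext p
  have := congrArg (fun X => (extMajorana p * X).trace) h
  simp only [trace_extMajorana_mul_extField] at this
  exact_mod_cast mul_right_cancel₀ (pow_ne_zero n two_ne_zero) this

/-! ### Linear equations characterising Gaussian operators -/

/-- The linear equations `[γ(v), X] = i {γ(N v), X}`, which determine a Gaussian operator `X`
up to a scalar factor. -/
def GaussianEquation (N : Matrix (Option (Fin (2 * n))) (Option (Fin (2 * n))) ℝ)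
    (X : Operator n) : Prop :=
  ∀ v, extField v * X - X * extField v = I • (extField (N *ᵥ v) * X + X * extField (N *ᵥ v))

theorem gaussianEquation_iff {N : Matrix (Option (Fin (2 * n))) (Option (Fin (2 * n))) ℝ}
    {X : Operator n} : GaussianEquation N X ↔ ∀ p, extMajorana p * X - X * extMajorana p =
      I • (extField (N *ᵥ Pi.single p 1) * X + X * extField (N *ᵥ Pi.single p 1)) := by
  refine ⟨fun h p => ?_, fun h v => ?_⟩
  · simpa [extField_single] using h (Pi.single p 1)
  · have hv : v = ∑ p, v p • (Pi.single p (1 : ℝ) : Option (Fin (2 * n)) → ℝ) := by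
      simpa [Pi.single_apply, eq_comm] using pi_eq_sum_univ' v
    have hv' : N *ᵥ v = ∑ p, v p • N *ᵥ Pi.single p 1 := by
      conv_lhs => rw [hv]
      rw [mulVec_sum]
      simp only [mulVec_smul]
    have hx := extField_apply (n := n) v
    have := Finset.sum_congr (rfl : Finset.univ = Finset.univ) fun p _ => congrArg (v p • ·) (h p)
    rw [hv', hx]
    simp only [map_sum, map_smul, Finset.sum_mul, Finset.mul_sum, smul_mul_assoc, mul_smul_comm,
      ← Finset.sum_sub_distrib, ← Finset.sum_add_distrib, Finset.smul_sum, ← smul_sub, ← smul_add,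
      smul_comm I] at this ⊢
    exact this

theorem GaussianEquation.conj {N R S : Matrix (Option (Fin (2 * n))) (Option (Fin (2 * n))) ℝ}
    {X U V : Operator n} (h : GaussianEquation N X) (hRS : R * S = 1) (hUV : U * V = 1)
    (hU : ∀ v, U * extField v = extField (R *ᵥ v) * U) :
    GaussianEquation (R * N * S) (U * X * V) := by
  have hVU : V * U = 1 := mul_eq_one_comm.mp hUV
  have hSR : S * R = 1 := mul_eq_one_comm.mp hRS
  have hV : ∀ v, extField v * V = V * extField (R *ᵥ v) := by
    intro v
    have := congrArg (fun Y => V * Y * V) (hU v)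
    simp only [mul_assoc, hUV, mul_one] at this
    simpa only [← mul_assoc, hVU, one_mul] using this
  have hleft : ∀ v, extField (R *ᵥ v) * (U * X * V) = U * (extField v * X) * V := by
    intro v
    simp only [← mul_assoc, hU]
  have hright : ∀ v, U * X * V * extField (R *ᵥ v) = U * (X * extField v) * V := by
    intro v
    simp only [mul_assoc, hV]
  intro v
  obtain ⟨w, rfl⟩ : ∃ w, v = R *ᵥ w := ⟨S *ᵥ v, by rw [mulVec_mulVec, hRS, one_mulVec]⟩
  have hN : (R * N * S) *ᵥ R *ᵥ w = R *ᵥ N *ᵥ w := by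
    rw [mulVec_mulVec, mul_assoc, hSR, mul_one, mulVec_mulVec]
  rw [hN, hleft, hleft, hright, hright, ← sub_mul, ← mul_sub, h w, ← add_mul, ← mul_add,
    mul_smul_comm, smul_mul_assoc]

/-! Uniqueness of the solution. -/

/-- The product of the generators listed in a word. -/
def wordProd (l : List (Option (Fin (2 * n)))) : Operator n := (l.map extMajorana).prod

theorem wordProd_cons (p : Option (Fin (2 * n))) (l : List (Option (Fin (2 * n)))) :
    wordProd (p :: l) = extMajorana p * wordProd l := by
  simp [wordProd]

/-- Moving a generator across a word costs a sign per letter, plus contractions that each delete one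
letter of the word. -/
theorem extMajorana_mul_wordProd_sub_mem (p : Option (Fin (2 * n)))
    (l : List (Option (Fin (2 * n)))) :
    extMajorana p * wordProd l - (-1 : ℂ) ^ l.length • (wordProd l * extMajorana p) ∈
      Submodule.span ℂ {X : Operator n | ∃ m, m.length + 1 = l.length ∧ X = wordProd m} := by
  induction l with
  | nil => simp [wordProd]
  | cons q l ih =>
    have h1 : extMajorana p * wordProd (q :: l) -
        (-1 : ℂ) ^ (q :: l).length • (wordProd (q :: l) * extMajorana p) =
        (if p = q then (2 : ℂ) else 0) • wordProd l - extMajorana q * (extMajorana p * wordProd l -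
          (-1 : ℂ) ^ l.length • (wordProd l * extMajorana p)) := by
      have hc := extMajorana_clifford p q
      have hc' : extMajorana p * extMajorana q = (if p = q then (2 : ℂ) else 0) • (1 : Operator n) -
          extMajorana q * extMajorana p := by
        rw [eq_sub_iff_add_eq, hc, ite_smul, zero_smul]
      rw [wordProd_cons, ← mul_assoc, hc', List.length_cons, pow_succ, sub_mul, smul_mul_assoc,
        one_mul, mul_sub, mul_smul_comm, mul_assoc, mul_assoc]
      module
    rw [h1]
    refine Submodule.sub_mem _ (Submodule.smul_mem _ _ (Submodule.subset_span ⟨l, by simp, rfl⟩)) ?_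
    refine Submodule.span_induction
      (p := fun X _ => extMajorana q * X ∈ Submodule.span ℂ
        {X : Operator n | ∃ m, m.length + 1 = (q :: l).length ∧ X = wordProd m}) ?_ ?_ ?_ ?_ ih
    · rintro _ ⟨m, hm, rfl⟩
      exact Submodule.subset_span ⟨q :: m, by simp [hm], (wordProd_cons q m).symm⟩
    · simp
    · intro X Y _ _ hX hY
      rw [mul_add]
      exact Submodule.add_mem _ hX hY
    · intro a X _ hX
      rw [mul_smul_comm]
      exact Submodule.smul_mem _ _ hX

/-- A Wick-type recursion. For T of odd length, {γ, T} is a combination of words one letter shorter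
than T, so tr(X{γ, T}) = 0 by induction. Tracing the equation against T then gives tr(X[γ_p, T]) = 0
as well, and tr(Xγ_pT) is half the sum. -/
theorem GaussianEquation.trace_mul_wordProd_eq_zero
    {N : Matrix (Option (Fin (2 * n))) (Option (Fin (2 * n))) ℝ} {X : Operator n}
    (h : GaussianEquation N X) (h0 : X.trace = 0) (k : ℕ) :
    ∀ l : List (Option (Fin (2 * n))), l.length = 2 * k → (X * wordProd l).trace = 0 := by
  induction k with
  | zero =>
    intro l hl
    rw [List.length_eq_zero_iff.mp hl]
    simpa [wordProd] using h0
  | succ k ih =>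
    intro l hl
    obtain ⟨p, T, rfl⟩ := List.exists_cons_of_length_eq_add_one (n := 2 * k + 1) (by omega)
    have hT : T.length = 2 * k + 1 := by rw [List.length_cons] at hl; omega
    have hspan : ∀ q, (X * (extMajorana q * wordProd T + wordProd T * extMajorana q)).trace = 0 := by
      intro q
      have hq := extMajorana_mul_wordProd_sub_mem q T
      rw [hT, pow_succ, pow_mul, neg_one_sq, one_pow, one_mul, neg_smul, one_smul,
        sub_neg_eq_add] at hq
      refine Submodule.span_induction (p := fun Y _ => (X * Y).trace = 0) ?_ ?_ ?_ ?_ hq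
      · rintro _ ⟨m, hm, rfl⟩
        exact ih m (by omega)
      · simp
      · intro Y Z _ _ hY hZ
        rw [mul_add, trace_add, hY, hZ, add_zero]
      · intro a Y _ hY
        rw [mul_smul_comm, trace_smul, hY, smul_zero]
    have hfield : ∀ v, (X * (extField v * wordProd T + wordProd T * extField v)).trace = 0 := by
      intro v
      simp only [extField_apply, Finset.sum_mul, Finset.mul_sum, smul_mul_assoc, mul_smul_comm,
        ← Finset.sum_add_distrib, ← smul_add, trace_sum, trace_smul, hspan, smul_zero,
        Finset.sum_const_zero]
    have hp := congrArg (fun Y => (Y * wordProd T).trace) (gaussianEquation_iff.mp h p)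
    have hcyc : ∀ Y : Operator n, (Y * X * wordProd T).trace = (X * (wordProd T * Y)).trace := by
      intro Y
      rw [mul_assoc, trace_mul_comm, mul_assoc]
    simp only [sub_mul, add_mul, smul_mul_assoc, trace_sub, trace_add, trace_smul, hcyc] at hp
    have hf := hfield (N *ᵥ Pi.single p 1)
    have hs := hspan p
    simp only [mul_add, trace_add, ← mul_assoc] at hf hs hp
    rw [add_comm, hf, smul_zero] at hp
    rw [wordProd_cons, ← mul_assoc]
    linear_combination (1 / 2) * hs - (1 / 2) * hp

/-- Each ĉ_p equals -i γ_p P, so words of even length already give all monomials, odd ones included.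
-/
theorem exists_monomial_eq_smul_wordProd (x : Fin (2 * n) → Fin 2) :
    ∃ (a : ℂ) (k : ℕ) (l : List (Option (Fin (2 * n)))), l.length = 2 * k ∧
      monomial x = a • wordProd l := by
  rw [monomial, List.ofFn_eq_map]
  induction List.finRange (2 * n) with
  | nil => exact ⟨1, 0, [], rfl, by simp [wordProd]⟩
  | cons p m ih =>
    obtain ⟨a, k, l, hl, h⟩ := ih
    rw [List.map_cons, List.prod_cons, h]
    generalize x p = y
    fin_cases y
    · exact ⟨a, k, l, hl, by simp⟩
    · refine ⟨-I * a, k + 1, some p :: none :: l, by simp [hl]; ring, ?_⟩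
      rw [wordProd_cons, wordProd_cons, ← mul_assoc, extMajorana_some_mul_none]
      simp only [smul_mul_assoc, mul_smul_comm, smul_smul]
      congr 1
      · linear_combination a * I_mul_I
      · simp

theorem GaussianEquation.eq_zero
    {N : Matrix (Option (Fin (2 * n))) (Option (Fin (2 * n))) ℝ} {X : Operator n}
    (h : GaussianEquation N X) (h0 : X.trace = 0) : X = 0 := by
  have hmon : ∀ x, (X * monomial x).trace = 0 := by
    intro x
    obtain ⟨a, k, l, hl, hx⟩ := exists_monomial_eq_smul_wordProd x
    rw [hx, mul_smul_comm, trace_smul, h.trace_mul_wordProd_eq_zero h0 k l hl, smul_zero]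
  rw [ext_iff_trace_mul_right]
  intro Y
  rw [zero_mul, trace_zero, ← (monomialBasis n).sum_repr Y, Finset.mul_sum, trace_sum]
  refine Finset.sum_eq_zero fun x _ => ?_
  rw [mul_smul_comm, trace_smul, monomialBasis, coe_basisOfLinearIndependentOfCardEqFinrank, hmon,
    smul_zero]

theorem GaussianEquation.eq_of_trace_eq
    {N : Matrix (Option (Fin (2 * n))) (Option (Fin (2 * n))) ℝ} {X Y : Operator n}
    (hX : GaussianEquation N X) (hY : GaussianEquation N Y) (h : X.trace = Y.trace) : X = Y := by
  rw [← sub_eq_zero]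
  refine GaussianEquation.eq_zero (N := N) (fun v => ?_) (by rw [trace_sub, h, sub_self])
  have h1 := congrArg₂ (· - ·) (hX v) (hY v)
  simp only [← smul_sub] at h1
  refine Eq.trans ?_ (h1.trans ?_)
  · noncomm_ring
  · congr 1
    noncomm_ring

/-! Conjugation by the exponential of a quadratic expression in the `extMajorana`. -/

theorem extMajorana_mul_mul_commutator (p q r : Option (Fin (2 * n))) :
    extMajorana p * extMajorana q * extMajorana r - extMajorana r * (extMajorana p * extMajorana q) =
      (if q = r then (2 : ℂ) else 0) • extMajorana p -
        (if p = r then (2 : ℂ) else 0) • (extMajorana q : Operator n) := by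
  have h1 : extMajorana q * extMajorana r = (if q = r then (2 : ℂ) else 0) • (1 : Operator n) -
      extMajorana r * extMajorana q := by
    rw [eq_sub_iff_add_eq, extMajorana_clifford, ite_smul, zero_smul]
  have h2 : extMajorana r * extMajorana p = (if p = r then (2 : ℂ) else 0) • (1 : Operator n) -
      extMajorana p * extMajorana r := by
    rw [eq_sub_iff_add_eq, add_comm, extMajorana_clifford, ite_smul, zero_smul]
  rw [mul_assoc, h1, ← mul_assoc, h2, mul_sub, sub_mul, mul_smul_comm, smul_mul_assoc, mul_one,
    one_mul, mul_assoc]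
  abel

/-- Only the antisymmetric part of c acts; the symmetric part contributes a scalar by the Clifford
relations. -/
theorem quadratic_commutator (c : Option (Fin (2 * n)) → Option (Fin (2 * n)) → ℂ)
    (r : Option (Fin (2 * n))) :
    (∑ p, ∑ q, c p q • (extMajorana p * extMajorana q)) * extMajorana r -
      extMajorana r * (∑ p, ∑ q, c p q • (extMajorana p * extMajorana q)) =
    ∑ p, (2 * (c p r - c r p)) • (extMajorana p : Operator n) := by
  simp only [Finset.sum_mul, Finset.mul_sum, smul_mul_assoc, mul_smul_comm,
    ← Finset.sum_sub_distrib, ← smul_sub, extMajorana_mul_mul_commutator, ite_smul,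
    zero_smul]
  simp only [Finset.sum_sub_distrib, smul_sub, smul_ite, smul_zero, smul_smul]
  simp only [Finset.sum_ite_eq', Finset.mem_univ, if_true]
  rw [Finset.sum_comm (f := fun p q => if p = r then (c p q * 2) • (extMajorana q : Operator n)
    else 0)]
  simp only [Finset.sum_ite_eq', Finset.mem_univ, if_true]
  rw [← Finset.sum_sub_distrib]
  refine Finset.sum_congr rfl fun p _ => ?_
  module

theorem commutator_extField {K : Operator n}
    {A : Matrix (Option (Fin (2 * n))) (Option (Fin (2 * n))) ℝ}
    (h : ∀ r, K * extMajorana r - extMajorana r * K = ∑ p, (A p r : ℂ) • extMajorana p)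
    (v : Option (Fin (2 * n)) → ℝ) :
    K * extField v - extField v * K = extField (A *ᵥ v) := by
  simp only [extField_apply, Finset.mul_sum, Finset.sum_mul, mul_smul_comm, smul_mul_assoc,
    ← Finset.sum_sub_distrib, ← smul_sub, h, Finset.smul_sum, mulVec, dotProduct, Finset.sum_smul]
  rw [Finset.sum_comm]
  refine Finset.sum_congr rfl fun p _ => Finset.sum_congr rfl fun q _ => ?_
  rw [mul_comm, mul_smul, Complex.coe_smul]

theorem exp_mul_extField {K : Operator n}
    {A : Matrix (Option (Fin (2 * n))) (Option (Fin (2 * n))) ℝ}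
    (h : ∀ v, K * extField v - extField v * K = extField (A *ᵥ v))
    (v : Option (Fin (2 * n)) → ℝ) :
    NormedSpace.exp K * extField v = extField (NormedSpace.exp A *ᵥ v) * NormedSpace.exp K := by
  let := Matrix.linftyOpNormedRing (n := Option (Fin (2 * n))) (α := ℝ)
  let := Matrix.linftyOpNormedAlgebra (n := Option (Fin (2 * n))) (R := ℝ) (α := ℝ)
  let := Matrix.linftyOpNormedRing (n := Fin n → Fin 2) (α := ℂ)
  let := Matrix.linftyOpNormedAlgebra (n := Fin n → Fin 2) (R := ℝ) (α := ℂ)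
  have := map_exp_mul_exp_of_commutator
    (LinearMap.toContinuousLinearMap
      (extField.comp ((mulVecBilin ℝ ℝ).flip v :
        Matrix (Option (Fin (2 * n))) (Option (Fin (2 * n))) ℝ →ₗ[ℝ] _))) K A (fun X => by
      simp only [LinearMap.coe_toContinuousLinearMap', LinearMap.comp_apply, LinearMap.flip_apply,
        mulVecBilin_apply, h, mulVec_mulVec])
  simp only [LinearMap.coe_toContinuousLinearMap', LinearMap.comp_apply, LinearMap.flip_apply,
    mulVecBilin_apply, one_mulVec] at this
  exact this.symm

theorem exp_mul_conjTranspose_exp {K : Operator n} (hK : Kᴴ = -K) :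
    NormedSpace.exp K * (NormedSpace.exp K)ᴴ = 1 := by
  rw [← Matrix.exp_conjTranspose, hK, ← Matrix.exp_add_of_commute _ _ (Commute.refl K).neg_right,
    add_neg_cancel, NormedSpace.exp_zero]

/-- For skew-Hermitian K the commutator with γ_r is Hermitian. Its coefficients, found by tracing
against the Hermitian γ_p, are therefore real even when c is not. -/
theorem exists_skew_of_skewHermitian {c : Option (Fin (2 * n)) → Option (Fin (2 * n)) → ℂ}
    {K : Operator n} (hc : K = ∑ p, ∑ q, c p q • (extMajorana p * extMajorana q))
    (hK : Kᴴ = -K) :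
    ∃ A : Matrix (Option (Fin (2 * n))) (Option (Fin (2 * n))) ℝ, Aᵀ = -A ∧
      ∀ v, K * extField v - extField v * K = extField (A *ᵥ v) := by
  have hr : ∀ p r, ((2 * (c p r - c r p)).re : ℂ) = 2 * (c p r - c r p) := by
    intro p r
    have h1 : (extMajorana p * (K * extMajorana r - extMajorana r * K)).trace =
        2 * (c p r - c r p) * 2 ^ n := by
      rw [hc, quadratic_commutator, Finset.mul_sum, trace_sum]
      simp [trace_extMajorana_mul]
    have h2 := trace_conjTranspose (extMajorana p * (K * extMajorana r - extMajorana r * K))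
    have h3 : (K * extMajorana r - extMajorana r * K)ᴴ = K * extMajorana r - extMajorana r * K := by
      simp only [conjTranspose_sub, conjTranspose_mul, hK, conjTranspose_extMajorana]
      noncomm_ring
    rw [conjTranspose_mul, conjTranspose_extMajorana, h3, trace_mul_comm, h1, star_mul',
      star_pow, star_ofNat] at h2
    exact (conj_eq_iff_re.mp (mul_right_cancel₀ (pow_ne_zero n two_ne_zero) h2).symm)
  refine ⟨Matrix.of fun p r => (2 * (c p r - c r p)).re, ?_, commutator_extField fun r => ?_⟩
  · ext p r
    simp
    ring
  · simp only [Matrix.of_apply, hr]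
    rw [hc, quadratic_commutator]

theorem hamiltonian_eq_sum_extMajorana (h : Fin (2 * n) → Fin (2 * n) → ℂ)
    (g : Fin (2 * n) → ℂ) :
    I • (∑ p, ∑ q, h p q • (majorana p * majorana q)) + I • ∑ p, g p • majorana p =
      ∑ p, ∑ q, (match p, q with
        | some p, some q => I * h p q
        | some p, none => g p
        | none, _ => 0 : ℂ) • (extMajorana p * extMajorana q : Operator n) := by
  simp only [Fintype.sum_option, zero_smul, Finset.sum_const_zero, zero_add,
    extMajorana_some_mul_some, extMajorana_some_mul_none, Finset.sum_add_distrib, Finset.smul_sum,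
    smul_smul]
  rw [add_comm]
  simp only [mul_comm]

theorem conjTranspose_hamiltonian {H₂ H₁ : Operator n} (h₂ : H₂.IsHermitian)
    (h₁ : H₁.IsHermitian) : (I • H₂ + I • H₁)ᴴ = -(I • H₂ + I • H₁) := by
  rw [conjTranspose_add, conjTranspose_smul, conjTranspose_smul, h₂, h₁]
  simp
  abel

theorem exists_skew_of_hamiltonian {H₂ H₁ : Operator n} (h₂ : IsQuadraticHamiltonian H₂)
    (h₁ : IsLinearHamiltonian H₁) :
    ∃ A : Matrix (Option (Fin (2 * n))) (Option (Fin (2 * n))) ℝ, Aᵀ = -A ∧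
      ∀ v, (I • H₂ + I • H₁) * extField v - extField v * (I • H₂ + I • H₁) =
        extField (A *ᵥ v) := by
  have hskew := conjTranspose_hamiltonian h₂.1 h₁.1
  obtain ⟨-, h, rfl⟩ := h₂
  obtain ⟨-, g, rfl⟩ := h₁
  exact exists_skew_of_skewHermitian (hamiltonian_eq_sum_extMajorana h g) hskew

theorem isLinearHamiltonian_zero : IsLinearHamiltonian (0 : Operator n) :=
  ⟨isHermitian_zero, 0, by simp⟩

theorem IsQuadraticHamiltonian.commute_parity {H : Operator n} (h : IsQuadraticHamiltonian H) :
    Commute H (parity n) := by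
  obtain ⟨-, h, rfl⟩ := h
  refine Commute.sum_left _ _ _ fun p _ => Commute.sum_left _ _ _ fun q _ => ?_
  refine Commute.smul_left ?_ _
  rw [Commute, SemiconjBy, mul_assoc, majorana_mul_parity, mul_neg, ← mul_assoc,
    majorana_mul_parity, neg_mul, neg_neg, mul_assoc]

theorem exists_hamiltonian_of_skew
    {A : Matrix (Option (Fin (2 * n))) (Option (Fin (2 * n))) ℝ} (hA : Aᵀ = -A) :
    ∃ H₂ H₁ : Operator n, IsQuadraticHamiltonian H₂ ∧ IsLinearHamiltonian H₁ ∧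
      (A *ᵥ Pi.single none 1 = 0 → H₁ = 0) ∧
      ∀ v, (I • H₂ + I • H₁) * extField v - extField v * (I • H₂ + I • H₁) =
        extField (A *ᵥ v) := by
  have hA' : ∀ p q, A q p = -A p q := fun p q => congrFun (congrFun hA p) q
  -- The action of c is 2(c_pr - c_rp). A skew block thus needs weight 1/4, while the parity column,
  -- entered on one side only, needs 1/2.
  refine ⟨∑ p, ∑ q, (-I * (A (some p) (some q) / 4 : ℝ)) • (majorana p * majorana q),
    ∑ p, ((A (some p) none / 2 : ℝ) : ℂ) • majorana p, ⟨?_, _, rfl⟩, ⟨?_, _, rfl⟩, fun h => ?_,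
    commutator_extField fun r => ?_⟩
  · rw [Matrix.IsHermitian, conjTranspose_sum]
    simp only [conjTranspose_sum, conjTranspose_smul, conjTranspose_mul, conjTranspose_majorana]
    rw [Finset.sum_comm]
    refine Finset.sum_congr rfl fun p _ => Finset.sum_congr rfl fun q _ => ?_
    rw [hA' (some p)]
    congr 1
    simp
    ring
  · rw [Matrix.IsHermitian, conjTranspose_sum]
    refine Finset.sum_congr rfl fun p _ => ?_
    rw [conjTranspose_smul, conjTranspose_majorana]
    simp
  · refine Finset.sum_eq_zero fun p _ => ?_
    have := congrFun h (some p)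
    rw [mulVec_single_one] at this
    simp only [col_apply, Pi.zero_apply] at this
    simp [this]
  · rw [hamiltonian_eq_sum_extMajorana, quadratic_commutator]
    refine Finset.sum_congr rfl fun p hp => ?_
    clear hp
    congr 1
    have h0 : A none none = 0 := by have := hA' none none; linarith
    rcases p with _ | p <;> rcases r with _ | r
    · simp [h0]
    · rw [hA' (some r) none]
      push_cast
      ring
    · push_cast
      ring
    · dsimp only
      rw [hA' (some p) (some r)]
      push_cast
      linear_combination (-(A (some p) (some r))) * I_mul_I

/-! The covariance of the standard Gaussian operators. -/

/-- The index of the first generator of the `j`-th pair. -/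
def evenIdx (j : Fin n) : Fin (2 * n) := ⟨2 * j, by omega⟩

/-- The index of the second generator of the `j`-th pair. -/
def oddIdx (j : Fin n) : Fin (2 * n) := ⟨2 * j + 1, by omega⟩

theorem eq_evenIdx_or_eq_oddIdx (p : Fin (2 * n)) : ∃ j, p = evenIdx j ∨ p = oddIdx j := by
  refine ⟨⟨(p : ℕ) / 2, by omega⟩, ?_⟩
  simp only [evenIdx, oddIdx, Fin.ext_iff]
  omega

theorem evenIdx_ne_oddIdx (i j : Fin n) : evenIdx i ≠ oddIdx j := by
  simp only [evenIdx, oddIdx, ne_eq, Fin.ext_iff]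
  omega

theorem evenIdx_inj {i j : Fin n} : evenIdx i = evenIdx j ↔ i = j := by
  simp only [evenIdx, Fin.ext_iff]
  omega

theorem oddIdx_inj {i j : Fin n} : oddIdx i = oddIdx j ↔ i = j := by
  simp only [oddIdx, Fin.ext_iff]
  omega

/-- The block diagonal antisymmetric matrix with the blocks `(0, λ_j; -λ_j, 0)` and a final
zero. -/
def blockForm (lam : Fin n → ℝ) : Matrix (Option (Fin (2 * n))) (Option (Fin (2 * n))) ℝ :=
  ∑ j, lam j • (single (some (evenIdx j)) (some (oddIdx j)) 1 -
    single (some (oddIdx j)) (some (evenIdx j)) 1)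

theorem blockForm_transpose (lam : Fin n → ℝ) : (blockForm lam)ᵀ = -blockForm lam := by
  simp only [blockForm, transpose_sum, transpose_smul, transpose_sub, transpose_single,
    ← Finset.sum_neg_distrib, ← smul_neg, neg_sub]

theorem blockForm_mulVec (lam : Fin n → ℝ) (x : Option (Fin (2 * n)) → ℝ) :
    blockForm lam *ᵥ x = ∑ j, lam j • (Pi.single (some (evenIdx j)) (x (some (oddIdx j))) -
      Pi.single (some (oddIdx j)) (x (some (evenIdx j)))) := by
  simp only [blockForm, sum_mulVec, smul_mulVec, sub_mulVec, single_mulVec, one_mul]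
  rfl

theorem blockForm_mulVec_none (lam : Fin n → ℝ) (x : Option (Fin (2 * n)) → ℝ) :
    (blockForm lam *ᵥ x) none = 0 := by
  simp [blockForm_mulVec]

theorem blockForm_mulVec_even (lam : Fin n → ℝ) (x : Option (Fin (2 * n)) → ℝ) (j : Fin n) :
    (blockForm lam *ᵥ x) (some (evenIdx j)) = lam j * x (some (oddIdx j)) := by
  simp [blockForm_mulVec, Pi.single_apply, evenIdx_ne_oddIdx, evenIdx_inj]

theorem blockForm_mulVec_odd (lam : Fin n → ℝ) (x : Option (Fin (2 * n)) → ℝ) (j : Fin n) :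
    (blockForm lam *ᵥ x) (some (oddIdx j)) = -(lam j * x (some (evenIdx j))) := by
  simp [blockForm_mulVec, Pi.single_apply, (evenIdx_ne_oddIdx _ _).symm, oddIdx_inj]

theorem blockForm_mulVec_single_none (lam : Fin n → ℝ) :
    blockForm lam *ᵥ Pi.single none 1 = 0 := by
  rw [blockForm_mulVec]
  simp

theorem blockForm_mulVec_single_even (lam : Fin n → ℝ) (j : Fin n) :
    blockForm lam *ᵥ Pi.single (some (evenIdx j)) 1 = Pi.single (some (oddIdx j)) (-lam j) := by
  rw [blockForm_mulVec, Finset.sum_eq_single j]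
  · simp [(evenIdx_ne_oddIdx j j).symm, ← Pi.single_neg, ← Pi.single_smul]
  · intro i _ hi
    simp [(evenIdx_ne_oddIdx j i).symm, evenIdx_inj, hi]
  · simp

theorem blockForm_mulVec_single_odd (lam : Fin n → ℝ) (j : Fin n) :
    blockForm lam *ᵥ Pi.single (some (oddIdx j)) 1 = Pi.single (some (evenIdx j)) (lam j) := by
  rw [blockForm_mulVec, Finset.sum_eq_single j]
  · simp [evenIdx_ne_oddIdx j j, ← Pi.single_smul]
  · intro i _ hi
    simp [evenIdx_ne_oddIdx i j, oddIdx_inj, hi]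
  · simp

/-- K² acts as -(j+1)² on the j-th coordinate plane and as 0 on the parity axis. These eigenvalues
are distinct (hence j+1, not j), so M preserves each eigenspace, and a skew map of a plane is a
multiple of the standard block. -/
theorem exists_eq_blockForm {M : Matrix (Option (Fin (2 * n))) (Option (Fin (2 * n))) ℝ}
    (hM : Mᵀ = -M) (hcomm : Commute (blockForm fun j : Fin n => ((j : ℕ) + 1 : ℝ)) M) :
    ∃ lam, M = blockForm lam := by
  set K := blockForm fun j : Fin n => ((j : ℕ) + 1 : ℝ) with hK
  have hM' : ∀ p q, M q p = -M p q := fun p q => congrFun (congrFun hM p) q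
  have hMM : ∀ p, M p p = 0 := fun p => by have := hM' p p; linarith
  have hKM : ∀ x, K *ᵥ (K *ᵥ (M *ᵥ x)) = M *ᵥ (K *ᵥ (K *ᵥ x)) := by
    intro x
    simpa only [← mulVec_mulVec] using congrArg (· *ᵥ x) (hcomm.mul_left hcomm).eq
  have hentry : ∀ p q, (M *ᵥ Pi.single q 1) p = M p q := fun p q => by
    rw [mulVec_single_one, col_apply]
  have hneg : ∀ (q : Option (Fin (2 * n))) (a : ℝ), (Pi.single q a : Option (Fin (2 * n)) → ℝ) =
      a • Pi.single q 1 := fun q a => by rw [← Pi.single_smul, smul_eq_mul, mul_one]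
  have he : ∀ j : Fin n, K *ᵥ (K *ᵥ Pi.single (some (evenIdx j)) 1) =
      (-((j : ℕ) + 1 : ℝ) ^ 2) • Pi.single (some (evenIdx j)) 1 := by
    intro j
    rw [hK, blockForm_mulVec_single_even, hneg, mulVec_smul, blockForm_mulVec_single_odd,
      hneg (some (evenIdx j)), smul_smul]
    congr 1
    ring
  have ho : ∀ j : Fin n, K *ᵥ (K *ᵥ Pi.single (some (oddIdx j)) 1) =
      (-((j : ℕ) + 1 : ℝ) ^ 2) • Pi.single (some (oddIdx j)) 1 := by
    intro j
    rw [hK, blockForm_mulVec_single_odd, hneg, mulVec_smul, blockForm_mulVec_single_even,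
      hneg (some (oddIdx j)), smul_smul]
    congr 1
    ring
  have hsq : ∀ i j : Fin n, i ≠ j → ((i : ℕ) + 1 : ℝ) ^ 2 ≠ ((j : ℕ) + 1 : ℝ) ^ 2 := by
    intro i j hij h
    rw [sq_eq_sq₀ (by positivity) (by positivity)] at h
    exact hij (Fin.ext (by exact_mod_cast add_right_cancel h))
  have hpos : ∀ i : Fin n, ((i : ℕ) + 1 : ℝ) ^ 2 ≠ 0 := fun i => by positivity
  have hnone : ∀ p, M p none = 0 := by
    have h := hKM (Pi.single none 1)
    rw [hK, blockForm_mulVec_single_none, mulVec_zero, mulVec_zero] at h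
    intro p
    rcases p with _ | p
    · exact hMM none
    obtain ⟨j, rfl | rfl⟩ := eq_evenIdx_or_eq_oddIdx p
    · have h1 := congrFun h (some (evenIdx j))
      rw [blockForm_mulVec_even, blockForm_mulVec_odd, hentry, Pi.zero_apply] at h1
      refine (mul_eq_zero.mp (?_ : ((j : ℕ) + 1 : ℝ) ^ 2 * _ = 0)).resolve_left (hpos j)
      linarith
    · have h1 := congrFun h (some (oddIdx j))
      rw [blockForm_mulVec_odd, blockForm_mulVec_even, hentry, Pi.zero_apply] at h1
      refine (mul_eq_zero.mp (?_ : ((j : ℕ) + 1 : ℝ) ^ 2 * _ = 0)).resolve_left (hpos j)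
      linarith
  have hcol : ∀ (j : Fin n) (q : Fin (2 * n)), q = evenIdx j ∨ q = oddIdx j →
      ∀ i, i ≠ j → M (some (evenIdx i)) (some q) = 0 ∧ M (some (oddIdx i)) (some q) = 0 := by
    intro j q hq i hij
    have h : K *ᵥ (K *ᵥ (M *ᵥ Pi.single (some q) 1)) =
        (-((j : ℕ) + 1 : ℝ) ^ 2) • M *ᵥ Pi.single (some q) 1 := by
      rw [hKM, ← mulVec_smul]
      rcases hq with rfl | rfl
      · rw [he]
      · rw [ho]
    have hs := sub_ne_zero.mpr (hsq i j hij)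
    constructor
    · have h1 := congrFun h (some (evenIdx i))
      rw [hK, blockForm_mulVec_even, blockForm_mulVec_odd, Pi.smul_apply, hentry, smul_eq_mul] at h1
      refine (mul_eq_zero.mp (?_ : (((i : ℕ) + 1 : ℝ) ^ 2 - ((j : ℕ) + 1 : ℝ) ^ 2) * _ =
        0)).resolve_left hs
      linarith
    · have h1 := congrFun h (some (oddIdx i))
      rw [hK, blockForm_mulVec_odd, blockForm_mulVec_even, Pi.smul_apply, hentry, smul_eq_mul] at h1
      refine (mul_eq_zero.mp (?_ : (((i : ℕ) + 1 : ℝ) ^ 2 - ((j : ℕ) + 1 : ℝ) ^ 2) * _ =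
        0)).resolve_left hs
      linarith
  refine ⟨fun j => M (some (evenIdx j)) (some (oddIdx j)), ?_⟩
  refine ext_of_mulVec_single fun q => funext fun p => ?_
  rw [hentry]
  rcases q with _ | q
  · rw [hnone, blockForm_mulVec_single_none, Pi.zero_apply]
  obtain ⟨j, hq⟩ := eq_evenIdx_or_eq_oddIdx q
  rcases p with _ | p
  · rw [hM', hnone, blockForm_mulVec_none, neg_zero]
  obtain ⟨i, hp⟩ := eq_evenIdx_or_eq_oddIdx p
  by_cases hij : i = j
  · subst hij
    rcases hp with rfl | rfl <;> rcases hq with rfl | rfl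
    · rw [hMM, blockForm_mulVec_single_even, Pi.single_eq_of_ne]
      simpa using evenIdx_ne_oddIdx i i
    · rw [blockForm_mulVec_single_odd, Pi.single_eq_same]
    · rw [blockForm_mulVec_single_even, Pi.single_eq_same, hM']
    · rw [hMM, blockForm_mulVec_single_odd, Pi.single_eq_of_ne]
      simpa using (evenIdx_ne_oddIdx i i).symm
  · have h := hcol j q hq i hij
    rcases hp with rfl | rfl <;> rcases hq with rfl | rfl
    · rw [h.1, blockForm_mulVec_even, Pi.single_eq_of_ne, mul_zero]
      simpa using (evenIdx_ne_oddIdx j i).symm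
    · rw [h.1, blockForm_mulVec_even, Pi.single_eq_of_ne, mul_zero]
      simpa [oddIdx_inj] using hij
    · rw [h.2, blockForm_mulVec_odd, Pi.single_eq_of_ne, mul_zero, neg_zero]
      simpa [evenIdx_inj] using hij
    · rw [h.2, blockForm_mulVec_odd, Pi.single_eq_of_ne, mul_zero, neg_zero]
      simpa using evenIdx_ne_oddIdx i j

/-- One factor `I - i λ ĉ_{2j-1} ĉ_{2j}` of a standard Gaussian operator. -/
noncomputable def gaussianFactor (lam : Fin n → ℝ) (j : Fin n) : Operator n :=
  1 - (I * (lam j : ℂ)) • (extMajorana (some (evenIdx j)) * extMajorana (some (oddIdx j)))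

theorem standardGaussian_eq (lam : Fin n → ℝ) :
    standardGaussian lam = ((1 : ℂ) / 2 ^ n) •
      ((List.finRange n).map (gaussianFactor lam)).prod := by
  rw [standardGaussian, List.ofFn_eq_map]
  refine congrArg (fun f => ((1 : ℂ) / 2 ^ n) • ((List.finRange n).map f).prod)
    (funext fun j => ?_)
  rw [gaussianFactor, extMajorana_some_mul_some]
  rfl

theorem commute_extMajorana_pair {p q r : Option (Fin (2 * n))} (hp : r ≠ p) (hq : r ≠ q) :
    Commute (extMajorana r) (extMajorana p * extMajorana q : Operator n) := by
  rw [Commute, SemiconjBy, ← mul_assoc, extMajorana_anticomm hp, neg_mul, mul_assoc,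
    extMajorana_anticomm hq, mul_neg, neg_neg, mul_assoc]

theorem commute_extMajorana_gaussianFactor (lam : Fin n → ℝ) {j : Fin n}
    {r : Option (Fin (2 * n))} (he : r ≠ some (evenIdx j)) (ho : r ≠ some (oddIdx j)) :
    Commute (extMajorana r) (gaussianFactor lam j) :=
  (Commute.one_right _).sub_right ((commute_extMajorana_pair he ho).smul_right _)

theorem commute_extMajorana_prod (lam : Fin n → ℝ) {l : List (Fin n)}
    {r : Option (Fin (2 * n))} (h : ∀ j ∈ l, r ≠ some (evenIdx j) ∧ r ≠ some (oddIdx j)) :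
    Commute (extMajorana r) (l.map (gaussianFactor lam)).prod := by
  refine Commute.list_prod_right _ _ fun X hX => ?_
  obtain ⟨j, hj, rfl⟩ := List.mem_map.mp hX
  exact commute_extMajorana_gaussianFactor lam (h j hj).1 (h j hj).2

theorem commute_even_prod (lam : Fin n → ℝ) {l : List (Fin n)} {j : Fin n} (h : j ∉ l) :
    Commute (extMajorana (some (evenIdx j))) (l.map (gaussianFactor lam)).prod :=
  commute_extMajorana_prod lam fun i hi =>
    ⟨by simpa [evenIdx_inj] using fun hji : j = i => h (hji ▸ hi),
      by simpa using evenIdx_ne_oddIdx j i⟩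

theorem commute_odd_prod (lam : Fin n → ℝ) {l : List (Fin n)} {j : Fin n} (h : j ∉ l) :
    Commute (extMajorana (some (oddIdx j))) (l.map (gaussianFactor lam)).prod :=
  commute_extMajorana_prod lam fun i hi =>
    ⟨by simpa using (evenIdx_ne_oddIdx i j).symm,
      by simpa [oddIdx_inj] using fun hji : j = i => h (hji ▸ hi)⟩

theorem trace_gaussianFactor_prod (lam : Fin n → ℝ) {l : List (Fin n)} (hl : l.Nodup) :
    ((l.map (gaussianFactor lam)).prod).trace = 2 ^ n := by
  induction l with
  | nil => simp [trace_one]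
  | cons j l ih =>
    obtain ⟨hj, hl⟩ := List.nodup_cons.mp hl
    set G := (l.map (gaussianFactor lam)).prod with hG
    have ha := commute_even_prod lam hj
    have h0 : (extMajorana (some (evenIdx j)) * extMajorana (some (oddIdx j)) * G).trace = 0 := by
      have h1 : (extMajorana (some (evenIdx j)) * extMajorana (some (oddIdx j)) * G).trace =
          -(extMajorana (some (evenIdx j)) * extMajorana (some (oddIdx j)) * G).trace := by
        -- Cycling the first generator round the trace commutes it with G but anticommutes it with
        -- its partner, so the trace equals its negative.
        conv_lhs => rw [mul_assoc, trace_mul_comm, mul_assoc, ← ha.eq, ← mul_assoc,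
          extMajorana_anticomm (by simpa using (evenIdx_ne_oddIdx j j).symm), neg_mul, trace_neg]
      exact self_eq_neg.mp h1
    rw [List.map_cons, List.prod_cons, gaussianFactor, sub_mul, one_mul, smul_mul_assoc, trace_sub,
      trace_smul, h0, smul_zero, sub_zero, ih hl]

theorem trace_standardGaussian (lam : Fin n → ℝ) : (standardGaussian lam).trace = 1 := by
  rw [standardGaussian_eq, trace_smul, trace_gaussianFactor_prod lam (List.nodup_finRange n),
    smul_eq_mul, one_div, inv_mul_cancel₀ (pow_ne_zero n two_ne_zero)]

/-- The generators of pair j commute with all factors of other pairs, which reduces the claim to a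
computation with the single factor j. -/
theorem gaussianFactor_prod_equation (lam : Fin n → ℝ) {l : List (Fin n)} (hl : l.Nodup)
    {j : Fin n} (hj : j ∈ l) :
    (extMajorana (some (evenIdx j)) * (l.map (gaussianFactor lam)).prod -
        (l.map (gaussianFactor lam)).prod * extMajorana (some (evenIdx j)) =
      (-I * lam j) • (extMajorana (some (oddIdx j)) * (l.map (gaussianFactor lam)).prod +
        (l.map (gaussianFactor lam)).prod * extMajorana (some (oddIdx j)))) ∧
    (extMajorana (some (oddIdx j)) * (l.map (gaussianFactor lam)).prod -
        (l.map (gaussianFactor lam)).prod * extMajorana (some (oddIdx j)) =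
      (I * lam j) • (extMajorana (some (evenIdx j)) * (l.map (gaussianFactor lam)).prod +
        (l.map (gaussianFactor lam)).prod * extMajorana (some (evenIdx j)))) := by
  induction l with
  | nil => simp at hj
  | cons k l ih =>
    obtain ⟨hk, hl⟩ := List.nodup_cons.mp hl
    rw [List.map_cons, List.prod_cons]
    by_cases hjk : j = k
    · subst hjk
      set G := (l.map (gaussianFactor lam)).prod with hG
      have ha : Commute (extMajorana (some (evenIdx j))) G := commute_even_prod lam hk
      have hb : Commute (extMajorana (some (oddIdx j))) G := commute_odd_prod lam hk
      set x : Operator n := extMajorana (some (evenIdx j)) with hx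
      set y : Operator n := extMajorana (some (oddIdx j)) with hy
      have hxx : x * x = 1 := extMajorana_mul_self _
      have hyy : y * y = 1 := extMajorana_mul_self _
      have hyx : y * x = -(x * y) :=
        extMajorana_anticomm (by simpa using (evenIdx_ne_oddIdx j j).symm)
      have hf : gaussianFactor lam j = 1 - (I * (lam j : ℂ)) • (x * y) := rfl
      have h1 : x * (x * y) = y := by rw [← mul_assoc, hxx, one_mul]
      have h2 : x * y * x = -y := by rw [mul_assoc, hyx, mul_neg, h1]
      have h3 : x * y * y = x := by rw [mul_assoc, hyy, mul_one]
      have h4 : y * (x * y) = -x := by rw [← mul_assoc, hyx, neg_mul, h3]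
      have e1 : x * gaussianFactor lam j - gaussianFactor lam j * x =
          (-I * lam j) • (y * gaussianFactor lam j + gaussianFactor lam j * y) := by
        simp only [hf, mul_sub, sub_mul, mul_smul_comm, smul_mul_assoc, h1, h2, h3, h4, mul_one,
          one_mul]
        module
      have e2 : y * gaussianFactor lam j - gaussianFactor lam j * y =
          (I * lam j) • (x * gaussianFactor lam j + gaussianFactor lam j * x) := by
        simp only [hf, mul_sub, sub_mul, mul_smul_comm, smul_mul_assoc, h1, h2, h3, h4, mul_one,
          one_mul]
        module
      constructor
      · rw [mul_assoc, mul_assoc, ← ha.eq, ← hb.eq]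
        simp only [← mul_assoc]
        rw [← sub_mul, ← add_mul, e1, smul_mul_assoc]
      · rw [mul_assoc, mul_assoc, ← ha.eq, ← hb.eq]
        simp only [← mul_assoc]
        rw [← sub_mul, ← add_mul, e2, smul_mul_assoc]
    · have hj' : j ∈ l := (List.mem_cons.mp hj).resolve_left hjk
      obtain ⟨i1, i2⟩ := ih hl hj'
      have hx := commute_extMajorana_gaussianFactor lam (j := k) (r := some (evenIdx j))
        (by simpa [evenIdx_inj] using hjk) (by simpa using evenIdx_ne_oddIdx j k)
      have hy := commute_extMajorana_gaussianFactor lam (j := k) (r := some (oddIdx j))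
        (by simpa using (evenIdx_ne_oddIdx k j).symm) (by simpa [oddIdx_inj] using hjk)
      simp only [← mul_assoc, hx.eq, hy.eq]
      simp only [mul_assoc, ← mul_sub, ← mul_add]
      rw [i1, i2, mul_smul_comm, mul_smul_comm]
      exact ⟨rfl, rfl⟩

theorem gaussianEquation_standardGaussian (lam : Fin n → ℝ) :
    GaussianEquation (blockForm lam) (standardGaussian lam) := by
  rw [gaussianEquation_iff, standardGaussian_eq]
  rintro (_ | p)
  · rw [blockForm_mulVec_single_none, map_zero, zero_mul, mul_zero, add_zero, smul_zero, sub_eq_zero]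
    exact ((commute_extMajorana_prod lam fun j _ => ⟨by simp, by simp⟩).smul_right _).eq
  · obtain ⟨j, hp⟩ := eq_evenIdx_or_eq_oddIdx p
    have h := gaussianFactor_prod_equation lam (List.nodup_finRange n) (List.mem_finRange j)
    rcases hp with rfl | rfl
    · rw [blockForm_mulVec_single_even, extField_single, mul_smul_comm, smul_mul_assoc, ← smul_sub,
        h.1]
      simp only [mul_smul_comm, smul_mul_assoc, ← Complex.coe_smul]
      push_cast
      module
    · rw [blockForm_mulVec_single_odd, extField_single, mul_smul_comm, smul_mul_assoc, ← smul_sub,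
        h.2]
      simp only [mul_smul_comm, smul_mul_assoc, ← Complex.coe_smul]
      module

/-! The product channel as a composition of channels attenuating a single generator. -/

theorem extMajorana_mul_majorana (r p : Fin (2 * n)) :
    extMajorana (some r) * majorana p =
      (if p = r then (-1 : ℂ) else 1) • (majorana p * extMajorana (some r)) := by
  have h : majorana r * parity n * majorana p = -(majorana r * majorana p) * parity n := by
    rw [mul_assoc, parity_mul_majorana, mul_neg, ← mul_assoc, neg_mul]
  simp only [extMajorana, smul_mul_assoc, mul_smul_comm, h]
  split_ifs with hpr
  · subst hpr
    rw [neg_one_smul, neg_mul, mul_assoc, smul_neg]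
  · rw [majorana_anticomm (Ne.symm hpr), neg_neg, one_smul, mul_assoc]

/-- γ_r anticommutes with ĉ_r and commutes with every other ĉ_p. Conjugation by ĉ_r itself would
also involve the parity of the degree. -/
theorem extMajorana_mul_monomial_mul (r : Fin (2 * n)) (x : Fin (2 * n) → Fin 2) :
    extMajorana (some r) * monomial x * extMajorana (some r) =
      ((-1 : ℂ) ^ (x r : ℕ)) • monomial x := by
  have hone : ∀ p, extMajorana (some r) * majorana p ^ (x p : ℕ) =
      (if p = r then (-1 : ℂ) ^ (x p : ℕ) else 1) •
        (majorana p ^ (x p : ℕ) * extMajorana (some r)) := by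
    intro p
    generalize x p = a
    fin_cases a
    · simp
    · simp [extMajorana_mul_majorana]
  have hs : ((-1 : ℂ) ^ (x r : ℕ)) = ∏ p, (if p = r then (-1 : ℂ) ^ (x p : ℕ) else 1) := by
    simp
  have hmain : extMajorana (some r) * monomial x =
      ((-1 : ℂ) ^ (x r : ℕ)) • (monomial x * extMajorana (some r)) := by
    rw [hs, monomial, ← List.prod_ofFn]
    simp only [List.ofFn_eq_map]
    induction List.finRange (2 * n) with
    | nil => simp
    | cons p l ih =>
      simp only [List.map_cons, List.prod_cons]
      rw [← mul_assoc, hone p, smul_mul_assoc, mul_assoc, ih, mul_smul_comm, smul_smul, mul_assoc]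
  rw [hmain, smul_mul_assoc, mul_assoc, extMajorana_mul_self, mul_one]

/-- The channel attenuating the generator number `r` by the factor `a`. -/
noncomputable def singleChannel (r : Fin (2 * n)) (a : ℝ) : Operator n →ₗ[ℂ] Operator n :=
  (((1 + a) / 2 : ℝ) : ℂ) • LinearMap.id + (((1 - a) / 2 : ℝ) : ℂ) •
    (LinearMap.mulLeft ℂ (extMajorana (some r)) ∘ₗ LinearMap.mulRight ℂ (extMajorana (some r)))

theorem singleChannel_apply (r : Fin (2 * n)) (a : ℝ) (X : Operator n) :
    singleChannel r a X = (((1 + a) / 2 : ℝ) : ℂ) • X + (((1 - a) / 2 : ℝ) : ℂ) •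
      (extMajorana (some r) * X * extMajorana (some r)) := by
  simp [singleChannel, mul_assoc]

theorem linearMap_ext_monomial {f g : Operator n →ₗ[ℂ] Operator n}
    (h : ∀ x, f (monomial x) = g (monomial x)) : f = g := by
  refine (monomialBasis n).ext fun x => ?_
  rw [monomialBasis, coe_basisOfLinearIndependentOfCardEqFinrank, h]

theorem productChannel_one : productChannel (1 : Fin (2 * n) → ℝ) = LinearMap.id := by
  refine linearMap_ext_monomial fun x => ?_
  simp [productChannel_monomial]

theorem productChannel_mul (b c : Fin (2 * n) → ℝ) :
    productChannel (b * c) = productChannel b ∘ₗ productChannel c := by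
  refine linearMap_ext_monomial fun x => ?_
  simp [productChannel_monomial, Finset.prod_mul_distrib, smul_smul, mul_comm]

/-- The weights (1+a)/2 and (1-a)/2 have sum 1 and difference a, the factors for monomials without
and with ĉ_r. -/
theorem productChannel_mulSingle (r : Fin (2 * n)) (a : ℝ) :
    productChannel (Pi.mulSingle r a) = singleChannel r a := by
  refine linearMap_ext_monomial fun x => ?_
  rw [productChannel_monomial, singleChannel_apply, extMajorana_mul_monomial_mul, smul_smul,
    ← add_smul]
  congr 1
  have h : ∀ p, ((Pi.mulSingle r a : Fin (2 * n) → ℝ) p : ℂ) = if p = r then (a : ℂ) else 1 := by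
    intro p
    rw [Pi.mulSingle_apply]
    split_ifs <;> simp
  simp only [h, Finset.prod_ite_eq', Finset.mem_filter, Finset.mem_univ, true_and]
  generalize x r = y
  fin_cases y
  · simp
    ring
  · simp
    ring

theorem trace_singleChannel (r : Fin (2 * n)) (a : ℝ) (X : Operator n) :
    (singleChannel r a X).trace = X.trace := by
  rw [singleChannel_apply, trace_add, trace_smul, trace_smul, trace_mul_comm (_ * X), ← mul_assoc,
    extMajorana_mul_self, one_mul, ← add_smul, ← ofReal_add]
  convert one_smul ℂ X.trace
  rw [ofReal_eq_one]
  ring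

theorem posSemidef_singleChannel (r : Fin (2 * n)) {a : ℝ} (h0 : 0 ≤ a) (h1 : a ≤ 1)
    {X : Operator n} (hX : X.PosSemidef) : (singleChannel r a X).PosSemidef := by
  have hc : (extMajorana (some r) * X * extMajorana (some r)).PosSemidef := by
    have := hX.mul_mul_conjTranspose_same (extMajorana (some r))
    rwa [conjTranspose_extMajorana] at this
  rw [singleChannel_apply]
  refine (hX.smul ?_).add (hc.smul ?_)
  · exact zero_le_real.mpr (by linarith)
  · exact zero_le_real.mpr (by linarith)

/-- The diagonal matrix of the attenuation coefficients, with the coefficient `1` for the parity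
operator. -/
def extDiagonal (b : Fin (2 * n) → ℝ) : Matrix (Option (Fin (2 * n))) (Option (Fin (2 * n))) ℝ :=
  diagonal fun p => p.elim 1 b

theorem extDiagonal_mul (b c : Fin (2 * n) → ℝ) :
    extDiagonal b * extDiagonal c = extDiagonal (b * c) := by
  rw [extDiagonal, extDiagonal, diagonal_mul_diagonal, extDiagonal]
  congr 1
  funext p
  cases p <;> simp

theorem extDiagonal_one : extDiagonal (1 : Fin (2 * n) → ℝ) = 1 := by
  rw [extDiagonal, ← diagonal_one]
  congr 1
  funext p
  cases p <;> simp

theorem extDiagonal_mulVec_single_none (b : Fin (2 * n) → ℝ) :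
    extDiagonal b *ᵥ Pi.single none 1 = Pi.single none 1 := by
  simp [extDiagonal]

/-- Conjugation by g = γ_r negates both P and each γ_p with p ≠ r, so the factor P on the right
makes the channel commute with both operations for those p. For p = r, conjugation by g negates {g,
X}P and [g, X] but fixes {g, X} and [g, X]P, which puts the factor a on opposite sides of the two
identities. -/
theorem singleChannel_anticommutator (r : Fin (2 * n)) (a : ℝ) (p : Option (Fin (2 * n)))
    (X : Operator n) :
    singleChannel r a ((extMajorana p * X + X * extMajorana p) * extMajorana none) =
      (p.elim 1 (Pi.mulSingle r a : Fin (2 * n) → ℝ) : ℝ) •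
        ((extMajorana p * singleChannel r a X + singleChannel r a X * extMajorana p) *
          extMajorana none) ∧
    (extMajorana p * singleChannel r a X - singleChannel r a X * extMajorana p) *
        extMajorana none =
      (p.elim 1 (Pi.mulSingle r a : Fin (2 * n) → ℝ) : ℝ) •
        singleChannel r a ((extMajorana p * X - X * extMajorana p) * extMajorana none) := by
  set P : Operator n := extMajorana none with hP
  set g : Operator n := extMajorana (some r) with hg
  have hgg : g * g = 1 := extMajorana_mul_self _
  have hPg : P * g = -(g * P) := extMajorana_anticomm (by simp)
  have hgg' : ∀ Y : Operator n, Y * g * g = Y := fun Y => by rw [mul_assoc, hgg, mul_one]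
  have hPg' : ∀ Y : Operator n, Y * P * g = -(Y * g * P) := fun Y => by
    rw [mul_assoc, hPg, mul_neg, mul_assoc]
  simp only [singleChannel_apply, ← hg]
  by_cases hp : p = some r
  · subst hp
    simp only [← hg, Option.elim_some, Pi.mulSingle_eq_same, mul_add, add_mul, mul_sub, sub_mul,
      mul_smul_comm, smul_mul_assoc, ← mul_assoc, hgg, one_mul, hPg', hgg',
      ← Complex.coe_smul]
    push_cast
    constructor <;> module
  · have he : p.elim 1 (Pi.mulSingle r a : Fin (2 * n) → ℝ) = 1 := by
      cases p with
      | none => rfl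
      | some p => exact Pi.mulSingle_eq_of_ne (M := fun _ => ℝ) (by simpa using hp) a
    set y : Operator n := extMajorana p with hy
    have hgy : g * y = -(y * g) := extMajorana_anticomm (Ne.symm hp)
    have hyg' : ∀ Y : Operator n, Y * y * g = -(Y * g * y) := fun Y => by
      rw [mul_assoc, mul_assoc, hgy, mul_neg, neg_neg]
    rw [he, one_smul, one_smul]
    simp only [mul_add, add_mul, mul_sub, sub_mul,
      mul_smul_comm, smul_mul_assoc, ← mul_assoc, hgy, hPg', hyg', neg_mul, neg_neg]
    constructor <;> module

/-- Apply the channel to the equation for γ_p multiplied by P. The commutator side yields B on the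
right of N, the anticommutator side yields B on the left, and the invertible P cancels. -/
theorem GaussianEquation.singleChannel
    {N : Matrix (Option (Fin (2 * n))) (Option (Fin (2 * n))) ℝ} {X : Operator n}
    (h : GaussianEquation N X) (r : Fin (2 * n)) (a : ℝ) :
    GaussianEquation (extDiagonal (Pi.mulSingle r a) * N * extDiagonal (Pi.mulSingle r a))
      (singleChannel r a X) := by
  set B := extDiagonal (Pi.mulSingle r a : Fin (2 * n) → ℝ) with hB
  have hE : ∀ v, Fermion.singleChannel r a ((extField v * X + X * extField v) * extMajorana none) =
      (extField (B *ᵥ v) * Fermion.singleChannel r a X +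
        Fermion.singleChannel r a X * extField (B *ᵥ v)) * extMajorana none := by
    intro v
    simp only [extField_apply, Finset.sum_mul, Finset.mul_sum, mul_smul_comm, smul_mul_assoc,
      ← Finset.sum_add_distrib, ← smul_add, map_sum]
    refine Finset.sum_congr rfl fun p _ => ?_
    rw [← Complex.coe_smul, map_smul, (singleChannel_anticommutator r a p X).1, hB, extDiagonal,
      mulVec_diagonal, Complex.coe_smul, smul_smul, mul_comm]
  rw [gaussianEquation_iff]
  intro p
  have hcancel : ∀ Y Z : Operator n, Y * extMajorana none = Z * extMajorana none → Y = Z := by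
    intro Y Z hYZ
    have := congrArg (· * extMajorana none) hYZ
    simpa only [mul_assoc, extMajorana_mul_self, mul_one] using this
  apply hcancel
  have hBp : B *ᵥ Pi.single p 1 =
      (p.elim 1 (Pi.mulSingle r a : Fin (2 * n) → ℝ) : ℝ) • Pi.single p 1 := by
    rw [hB, extDiagonal, diagonal_mulVec_single, mul_one, ← Pi.single_smul, smul_eq_mul, mul_one]
  rw [(singleChannel_anticommutator r a p X).2, gaussianEquation_iff.mp h p, smul_mul_assoc,
    map_smul, hE, ← mulVec_mulVec, hBp, mulVec_smul, ← mulVec_mulVec, map_smul]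
  simp only [smul_mul_assoc, mul_smul_comm, ← smul_add]
  rw [smul_comm]

theorem productChannel_properties {b : Fin (2 * n) → ℝ} (hb : ∀ p, 0 ≤ b p ∧ b p ≤ 1)
    {N : Matrix (Option (Fin (2 * n))) (Option (Fin (2 * n))) ℝ} {X : Operator n}
    (h : GaussianEquation N X) (hX : IsState X) :
    GaussianEquation (extDiagonal b * N * extDiagonal b) (productChannel b X) ∧
      IsState (productChannel b X) := by
  have key : ∀ s : Finset (Fin (2 * n)),
      GaussianEquation (extDiagonal (∏ r ∈ s, Pi.mulSingle r (b r)) * N *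
        extDiagonal (∏ r ∈ s, Pi.mulSingle r (b r)))
        (productChannel (∏ r ∈ s, Pi.mulSingle r (b r)) X) ∧
      IsState (productChannel (∏ r ∈ s, Pi.mulSingle r (b r)) X) := by
    intro s
    induction s using Finset.induction_on with
    | empty => simpa [extDiagonal_one, productChannel_one] using ⟨h, hX⟩
    | insert r s hr ih =>
      rw [Finset.prod_insert hr, productChannel_mul, productChannel_mulSingle, LinearMap.comp_apply]
      refine ⟨?_, posSemidef_singleChannel r (hb r).1 (hb r).2 ih.2.1, ?_⟩
      · convert ih.1.singleChannel r (b r) using 1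
        simp only [← mul_assoc, extDiagonal_mul]
        simp only [mul_assoc, extDiagonal_mul]
        rw [mul_comm (Pi.mulSingle r (b r)) (∏ r ∈ s, Pi.mulSingle r (b r))]
      · rw [trace_singleChannel, ih.2.2]
  have := key Finset.univ
  rwa [Finset.univ_prod_mulSingle] at this

/-! ### Covariance matrices and the characterisation of Gaussian states -/

theorem covarianceMatrix_eq {N : Matrix (Option (Fin (2 * n))) (Option (Fin (2 * n))) ℝ}
    {X : Operator n} (h : GaussianEquation N X) (hX : X.trace = 1) (p q : Fin (2 * n)) :
    covarianceMatrix X p q = -(N (some q) (some p) : ℂ) := by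
  -- Traced against γ_q, the anticommutator side becomes tr(X{γ_q, γ(w)}), and {γ_q, γ(w)} is the
  -- scalar 2w_q.
  have hp := congrArg (fun Y => (Y * extMajorana (some q)).trace)
    (gaussianEquation_iff.mp h (some p))
  set w := N *ᵥ Pi.single (some p) 1 with hw
  have hwq : w (some q) = N (some q) (some p) := by rw [hw, mulVec_single_one, col_apply]
  have hanti : extField w * extMajorana (some q) + extMajorana (some q) * extField w =
      (2 * (w (some q) : ℂ)) • (1 : Operator n) := by
    simp only [extField_apply, Finset.sum_mul, Finset.mul_sum, mul_smul_comm, smul_mul_assoc,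
      ← Finset.sum_add_distrib, ← smul_add, extMajorana_clifford, smul_ite, smul_zero]
    rw [Finset.sum_ite_eq', if_pos (Finset.mem_univ _), ← Complex.coe_smul, smul_smul, mul_comm]
  have hcyc : ∀ Y : Operator n, (Y * X * extMajorana (some q)).trace =
      (X * (extMajorana (some q) * Y)).trace := by
    intro Y
    rw [mul_assoc, trace_mul_comm, mul_assoc]
  have hcyc' : ∀ Y : Operator n, (X * Y * extMajorana (some q)).trace =
      (X * (Y * extMajorana (some q))).trace := fun Y => by rw [mul_assoc]
  simp only [sub_mul, smul_mul_assoc, add_mul, trace_sub, trace_smul, trace_add, hcyc, hcyc'] at hp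
  rw [← trace_add, ← mul_add, add_comm, hanti, mul_smul_comm, mul_one, trace_smul, hX,
    extMajorana_some_mul_some, extMajorana_some_mul_some, hwq] at hp
  rw [covarianceMatrix, Matrix.of_apply, mul_sub, trace_sub]
  simp only [smul_eq_mul] at hp
  linear_combination (I / 2) * hp + (N (some q) (some p) : ℂ) * I_mul_I

theorem gaussianEquation_of_exp {A N : Matrix (Option (Fin (2 * n))) (Option (Fin (2 * n))) ℝ}
    {H₂ H₁ X : Operator n} (h₂ : H₂.IsHermitian) (h₁ : H₁.IsHermitian)
    (hA : ∀ v, (I • H₂ + I • H₁) * extField v - extField v * (I • H₂ + I • H₁) =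
      extField (A *ᵥ v)) (hX : GaussianEquation N X) :
    GaussianEquation (NormedSpace.exp A * N * NormedSpace.exp (-A))
      (NormedSpace.exp (I • H₂ + I • H₁) * X * (NormedSpace.exp (I • H₂ + I • H₁))ᴴ) :=
  hX.conj (exp_mul_exp_neg A) (exp_mul_conjTranspose_exp (conjTranspose_hamiltonian h₂ h₁))
    (exp_mul_extField hA)

theorem exp_conj_transpose {A N : Matrix (Option (Fin (2 * n))) (Option (Fin (2 * n))) ℝ}
    (hA : Aᵀ = -A) (hN : Nᵀ = -N) :
    (NormedSpace.exp A * N * NormedSpace.exp (-A))ᵀ =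
      -(NormedSpace.exp A * N * NormedSpace.exp (-A)) := by
  rw [← transpose_exp_of_skew hA]
  simp only [transpose_mul, transpose_transpose, hN, mul_neg, neg_mul, mul_assoc]

theorem IsGaussian.exists_gaussianEquation {ρ : Operator n} (h : IsGaussian ρ) :
    ∃ N, Nᵀ = -N ∧ GaussianEquation N ρ := by
  obtain ⟨-, lam, H₂, H₁, h₂, h₁, rfl⟩ := h
  obtain ⟨A, hA, hAv⟩ := exists_skew_of_hamiltonian h₂ h₁
  exact ⟨_, exp_conj_transpose hA (blockForm_transpose lam),
    gaussianEquation_of_exp h₂.1 h₁.1 hAv (gaussianEquation_standardGaussian lam)⟩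

theorem IsEvenGaussian.exists_gaussianEquation {ρ : Operator n} (h : IsEvenGaussian ρ) :
    ∃ N, Nᵀ = -N ∧ N *ᵥ Pi.single none 1 = 0 ∧ GaussianEquation N ρ := by
  obtain ⟨-, lam, H₂, h₂, rfl⟩ := h
  obtain ⟨A, hA, hAv⟩ := exists_skew_of_hamiltonian h₂ isLinearHamiltonian_zero
  refine ⟨_, exp_conj_transpose hA (blockForm_transpose lam), ?_, by
    simpa using gaussianEquation_of_exp h₂.1 isLinearHamiltonian_zero.1 hAv
      (gaussianEquation_standardGaussian lam)⟩
  -- An even Hamiltonian commutes with P = γ(e), where e is the parity axis, so γ(Ae) = 0.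
  have hA0 : A *ᵥ Pi.single none 1 = 0 := by
    apply extField_injective
    rw [← hAv, map_zero, extField_single, one_smul, smul_zero, add_zero, sub_eq_zero]
    exact (h₂.commute_parity.smul_left I).eq
  rw [← mulVec_mulVec, ← mulVec_mulVec, exp_mulVec_of_mulVec_eq_zero (A := -A) (by
    rw [neg_mulVec, hA0, neg_zero]), blockForm_mulVec_single_none, mulVec_zero]

/-- Rotating N to block form yields λ and a Hamiltonian whose Gaussian operator solves the same
equations with the same trace, so it is X. If W contains the parity axis, the rotation's generator
kills it and the linear part vanishes. -/
theorem GaussianEquation.exists_eq_exp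
    {N : Matrix (Option (Fin (2 * n))) (Option (Fin (2 * n))) ℝ} {X : Operator n}
    (h : GaussianEquation N X) (hN : Nᵀ = -N) (hX : X.trace = 1)
    (W : Set (Option (Fin (2 * n)) → ℝ)) (hW : ∀ x ∈ W, x = Pi.single none 1)
    (hNW : ∀ x ∈ W, N *ᵥ x = 0) :
    ∃ (lam : Fin n → ℝ) (H₂ H₁ : Operator n),
      IsQuadraticHamiltonian H₂ ∧ IsLinearHamiltonian H₁ ∧
      (Pi.single none 1 ∈ W → H₁ = 0) ∧
      X = NormedSpace.exp (I • H₂ + I • H₁) * standardGaussian lam *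
        (NormedSpace.exp (I • H₂ + I • H₁))ᴴ := by
  obtain ⟨A, hA, hAW, hcomm⟩ := exists_skew_exp_conj_commute hN
    (blockForm_transpose fun j : Fin n => ((j : ℕ) + 1 : ℝ)) W hNW
    (fun x hx => by rw [hW x hx, blockForm_mulVec_single_none])
  obtain ⟨lam, hlam⟩ := exists_eq_blockForm (by
    have := exp_conj_transpose (A := -A) (N := N) (by rw [transpose_neg, hA]) hN
    rwa [neg_neg] at this) hcomm
  obtain ⟨H₂, H₁, h₂, h₁, h0, hv⟩ := exists_hamiltonian_of_skew hA
  refine ⟨lam, H₂, H₁, h₂, h₁, fun hmem => h0 (hAW _ hmem), ?_⟩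
  have hY := gaussianEquation_of_exp h₂.1 h₁.1 hv (gaussianEquation_standardGaussian lam)
  have hNe : NormedSpace.exp A * blockForm lam * NormedSpace.exp (-A) = N := by
    simp only [← hlam, mul_assoc, exp_mul_exp_neg, mul_one]
    rw [← mul_assoc, exp_mul_exp_neg, one_mul]
  rw [hNe] at hY
  refine h.eq_of_trace_eq hY ?_
  rw [trace_mul_comm, ← mul_assoc, mul_eq_one_comm.mp
    (exp_mul_conjTranspose_exp (conjTranspose_hamiltonian h₂.1 h₁.1)), one_mul, hX,
    trace_standardGaussian]

theorem GaussianEquation.isGaussian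
    {N : Matrix (Option (Fin (2 * n))) (Option (Fin (2 * n))) ℝ} {X : Operator n}
    (h : GaussianEquation N X) (hN : Nᵀ = -N) (hX : IsState X) : IsGaussian X := by
  obtain ⟨lam, H₂, H₁, h₂, h₁, -, heq⟩ := h.exists_eq_exp hN hX.2 ∅ (by simp) (by simp)
  exact ⟨hX, lam, H₂, H₁, h₂, h₁, heq⟩

theorem GaussianEquation.isEvenGaussian
    {N : Matrix (Option (Fin (2 * n))) (Option (Fin (2 * n))) ℝ} {X : Operator n}
    (h : GaussianEquation N X) (hN : Nᵀ = -N) (hN0 : N *ᵥ Pi.single none 1 = 0)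
    (hX : IsState X) : IsEvenGaussian X := by
  obtain ⟨lam, H₂, H₁, h₂, -, h0, heq⟩ := h.exists_eq_exp hN hX.2 {Pi.single none 1} (by simp)
    (by simpa using hN0)
  refine ⟨hX, lam, H₂, h₂, ?_⟩
  rw [heq, h0 rfl, smul_zero, add_zero]

theorem extDiagonal_conj_transpose (b : Fin (2 * n) → ℝ)
    {N : Matrix (Option (Fin (2 * n))) (Option (Fin (2 * n))) ℝ} (hN : Nᵀ = -N) :
    (extDiagonal b * N * extDiagonal b)ᵀ = -(extDiagonal b * N * extDiagonal b) := by
  simp only [transpose_mul, hN, extDiagonal, diagonal_transpose, mul_neg, neg_mul, mul_assoc]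

end Fermion

theorem mainTheorem5 (n : ℕ) (b : Fin (2 * n) → ℝ) (hb : ∀ p, 0 ≤ b p ∧ b p ≤ 1) :
    (∀ ρ : Fermion.Operator n, Fermion.IsGaussian ρ →
      Fermion.IsGaussian (Fermion.productChannel b ρ)) ∧
    (∀ ρ : Fermion.Operator n, Fermion.IsEvenGaussian ρ →
      Fermion.IsEvenGaussian (Fermion.productChannel b ρ) ∧
      Fermion.covarianceMatrix (Fermion.productChannel b ρ) =
        Matrix.diagonal (fun p => (b p : ℂ)) * Fermion.covarianceMatrix ρ *
          (Matrix.diagonal (fun p => (b p : ℂ))).transpose) := by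

  refine ⟨fun ρ hρ => ?_, fun ρ hρ => ?_⟩
  · obtain ⟨N, hN, hsys⟩ := hρ.exists_gaussianEquation
    obtain ⟨h1, h2⟩ := Fermion.productChannel_properties hb hsys hρ.1
    exact h1.isGaussian (Fermion.extDiagonal_conj_transpose b hN) h2
  · obtain ⟨N, hN, hN0, hsys⟩ := hρ.exists_gaussianEquation
    obtain ⟨h1, h2⟩ := Fermion.productChannel_properties hb hsys hρ.1
    refine ⟨h1.isEvenGaussian (Fermion.extDiagonal_conj_transpose b hN) ?_ h2, ?_⟩
    -- Evenness persists because the extended diagonal has coefficient 1 on the parity axis.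
    · rw [← Matrix.mulVec_mulVec, ← Matrix.mulVec_mulVec, Fermion.extDiagonal_mulVec_single_none,
        hN0, Matrix.mulVec_zero]
    · ext p q
      rw [Fermion.covarianceMatrix_eq h1 h2.2, Matrix.diagonal_transpose, Matrix.mul_diagonal,
        Matrix.diagonal_mul, Fermion.covarianceMatrix_eq hsys hρ.1.2, Fermion.extDiagonal,
        Matrix.mul_diagonal, Matrix.diagonal_mul]
      push_cast
      simp only [Option.elim_some]
      ring
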